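/- Let $\mathfrak g$ be a Lie superalgebra over $\mathbb C$ and let $\mathfrak{sl}_2=\langle e,h,f\rangle\subset\mathfrak g$ be a subalgebra (of even elements, with $[h,e]=2e$, $[h,f]=-2f$, $[e,f]=h$) whose adjoint action on $\mathfrak g$ is locally finite. Modules are $\mathbb Z/2$-graded and morphisms are the even $U(\mathfrak g)$-linear maps. The powers of $f$ form an Ore set in $U(\mathfrak g)$; for a $\mathfrak g$-module $N$ let $N[f^{-1}]=U(\mathfrak g)[f^{-1}]\otimes_{U(\mathfrak g)}N$. For $a\in\mathbb C$ let $\phi_a(u)=\sum_{i\ge0}\binom ai(\mathrm{ad} f)^i(u)f^{-i}$ on $U(\mathfrak g)[f^{-1}]$, and let $\mathcal D_a(N)=\{f^a\otimes w: w\in N[f^{-1}]\}$ be the twisted localization, a copy of $N[f^{-1}]$ with the action $u(f^a\otimes w)=f^a\otimes\phi_{-a}(u)w$ (so that $f^a u=\phi_a(u)f^a$). Let $\mathcal C_a(N)=\{x\in\mathcal D_a(N):\dim\mathbb C[e]x<\infty\}$ be the Enright functor. For $b\in\mathbb C$ let $\mathcal M(b)^e$ be the full subcategory of $\mathfrak g$-modules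 on which $h$ acts diagonally with eigenvalues in $b+\mathbb Z$ and $e$ acts locally nilpotently; $\mathcal C_a$ restricts to a functor $\mathcal M(a)^e\to\mathcal M(-a)^e$. For a $\mathfrak g$-module $N$ put $N^f=\{v\in N: f^sv=0\text{ for }s\gg0\}$. (i) For every $a\in\mathbb C$ there is a canonical natural transformation $\Phi:\mathrm{Id}_{\mathcal M(a)^e}\to\mathcal C_{-a}\mathcal C_a$, namely one such that for all $M\in\mathcal M(a)^e$ and $v\in M$ the image of $\Phi_M(v)$ under $\mathcal C_{-a}\mathcal C_aM\subset\mathcal D_{-a}\mathcal C_aM\to\mathcal D_{-a}\mathcal D_aM$ is $f^{-a}\otimes(f^a\otimes v)$. (ii) If $a\notin\mathbb Z$, then $\mathcal C_a:\mathcal M(a)^e\to\mathcal M(-a)^e$ is an equivalence of categories. (iii) Let $N_1,N_2\in\mathcal M(0)^e$ be such that $N_2^f=0$. Then the natural map $\mathrm{Hom}_{\mathfrak g}(N_1,N_2)\to\mathrm{Hom}_{\mathfrak g}(\mathcal C_0(N_1),\mathcal C_0(N_2))$ is injective, and hence $\dim\mathrm{Hom}_{\mathfrak g}(N_1,N_2)\le\dim\mathrm{Hom}_{\mathfrak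 g}(\mathcal C_0(N_1),\mathcal C_0(N_2))$. -/

import Mathlib

open CategoryTheory
universe u

namespace TwistedLocalization

section OreLemmas

variable {R : Type u} [Ring R] [Algebra ℂ R]

/-- The operator `ad f : u ↦ f u - u f`. -/
def adj (f : R) : Module.End ℂ R := LinearMap.mulLeft ℂ f - LinearMap.mulRight ℂ f

theorem adj_apply (f u : R) : adj f u = f * u - u * f := rfl

theorem ad_mul (f u v : R) : adj f (u * v) =
    adj f u * v + u * adj f v := by
  simp only [adj_apply]
  noncomm_ring

theorem ad_pow_of_le {f u : R} {m n : ℕ} (h : (adj f ^ m) u = 0) (hmn : m ≤ n) :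
    (adj f ^ n) u = 0 := by
  obtain ⟨k, rfl⟩ := Nat.exists_eq_add_of_le hmn
  rw [add_comm, pow_add, Module.End.mul_apply, h, map_zero]

theorem ad_pow_mul_eq_zero (f : R) : ∀ (N m n : ℕ) (u v : R), m + n ≤ N →
    (adj f ^ m) u = 0 → (adj f ^ n) v = 0 →
    (adj f ^ N) (u * v) = 0 := by
  intro N
  induction N with
  | zero =>
    intro m n u v hmn hu hv
    obtain rfl : m = 0 := by omega
    simp only [pow_zero, Module.End.one_apply] at hu ⊢
    rw [hu, zero_mul]
  | succ N ih =>
    intro m n u v hmn hu hv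
    rcases m with _ | m
    · simp only [pow_zero, Module.End.one_apply] at hu
      rw [hu, zero_mul, map_zero]
    rcases n with _ | n
    · simp only [pow_zero, Module.End.one_apply] at hv
      rw [hv, mul_zero, map_zero]
    rw [pow_succ, Module.End.mul_apply, ad_mul, map_add,
      ih m (n + 1) _ _ (by omega) (by rw [← Module.End.mul_apply, ← pow_succ]; exact hu) hv,
      ih (m + 1) n _ _ (by omega) hu (by rw [← Module.End.mul_apply, ← pow_succ]; exact hv),
      add_zero]

theorem commute_ad_mulRight (f g : R) (h : Commute f g) :
    Commute (adj f) (LinearMap.mulRight ℂ g) := by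
  ext u
  simp only [Module.End.mul_apply, LinearMap.mulRight_apply, ad_mul]
  simp [adj_apply, h.eq]

theorem ad_pow_mul_right (f g u : R) (h : Commute f g) (i : ℕ) :
    (adj f ^ i) (u * g) = (adj f ^ i) u * g := by
  have := LinearMap.congr_fun ((commute_ad_mulRight f g h).pow_left i).eq u
  simpa using this

theorem pow_mul_eq_sum (f u : R) (n : ℕ) : f ^ n * u =
    ∑ i ∈ Finset.range (n + 1), (n.choose i) • ((adj f ^ i) u * f ^ (n - i)) := by
  have h1 : LinearMap.mulLeft ℂ f = adj f + LinearMap.mulRight ℂ f := by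
    ext u; simp [adj_apply]
  have h2 := (commute_ad_mulRight f f (Commute.refl f)).add_pow n
  rw [← h1] at h2
  have h3 := LinearMap.congr_fun h2 u
  rw [LinearMap.pow_mulLeft] at h3
  simp only [LinearMap.mulLeft_apply, LinearMap.sum_apply] at h3
  rw [h3]
  refine Finset.sum_congr rfl fun i _ => ?_
  rw [← (Nat.cast_commute _ _).eq, ← nsmul_eq_mul,
    ((commute_ad_mulRight f f (Commute.refl f)).pow_pow i (n - i)).eq, LinearMap.pow_mulRight]
  rfl

theorem pow_mul_eq_sum' (f u : R) (n k : ℕ) (h : (adj f ^ n) u = 0) :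
    f ^ (n + k) * u = ∑ i ∈ Finset.range n,
      ((n + k).choose i) • ((adj f ^ i) u * f ^ (n - i) * f ^ k) := by
  rw [pow_mul_eq_sum, ← Finset.sum_subset (s₁ := Finset.range n)
    (Finset.range_subset_range.mpr (by omega))]
  · refine Finset.sum_congr rfl fun i hi => ?_
    rw [Finset.mem_range] at hi
    rw [mul_assoc, ← pow_add, show n - i + k = n + k - i by omega]
  · intro i _ hi
    rw [Finset.mem_range, not_lt] at hi
    rw [ad_pow_of_le h hi, zero_mul, smul_zero]

theorem nonempty_oreSet (f : R) (hf : ∀ u : R, ∃ n : ℕ, (adj f ^ n) u = 0) :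
    Nonempty (OreLocalization.OreSet (Submonoid.powers f)) := by
  rw [OreLocalization.nonempty_oreSet_iff]
  constructor
  · rintro r₁ r₂ ⟨_, k, rfl⟩ h
    obtain ⟨n, hn⟩ := hf (r₁ - r₂)
    refine ⟨⟨f ^ (n + k), n + k, rfl⟩, ?_⟩
    change f ^ (n + k) * r₁ = f ^ (n + k) * r₂
    rw [← sub_eq_zero, ← mul_sub, pow_mul_eq_sum' f _ n k hn]
    refine Finset.sum_eq_zero fun i _ => ?_
    have h0 : (r₁ - r₂) * f ^ k = 0 := by
      rw [sub_mul, sub_eq_zero]; exact h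
    rw [mul_assoc, ← pow_add, add_comm (n - i), pow_add, ← mul_assoc,
      ← ad_pow_mul_right _ _ _ ((Commute.refl f).pow_right k), h0, map_zero, zero_mul, smul_zero]
  · rintro r ⟨_, k, rfl⟩
    obtain ⟨n, hn⟩ := hf r
    refine ⟨∑ i ∈ Finset.range n,
      ((n + k).choose i) • ((adj f ^ i) r * f ^ (n - i)),
      ⟨f ^ (n + k), n + k, rfl⟩, ?_⟩
    change f ^ (n + k) * r = _ * f ^ k
    rw [pow_mul_eq_sum' f _ n k hn, Finset.sum_mul]
    simp only [smul_mul_assoc]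

end OreLemmas

section Phi

variable {A : Type u} [Ring A] [Algebra ℂ A]

theorem finsum_eq_of_zero {x : ℕ → A} (c : ℕ → ℂ) {N : ℕ} (h : ∀ i, N ≤ i → x i = 0) :
    ∑ᶠ i : ℕ, c i • x i = ∑ i ∈ Finset.range N, c i • x i := by
  apply finsum_eq_sum_of_support_subset
  intro i hi
  by_contra hc
  simp only [Finset.coe_range, Set.mem_Iio, not_lt] at hc
  exact hi (by simp [h i hc])

theorem eval_choosePoly (i : ℕ) (a : ℂ) :
    (Polynomial.C ((i.factorial : ℂ)⁻¹) * descPochhammer ℂ i).eval a = Ring.choose a i := by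
  rw [Ring.choose_eq_smul, Polynomial.eval_mul, Polynomial.eval_C, smul_eq_mul]
  congr 1
  rw [← descPochhammer_map (Int.castRingHom ℂ), Polynomial.eval_map,
    ← Polynomial.aeval_eq_smeval]
  rfl

theorem conj_eq_sum (F : Aˣ) (u : A) (n : ℕ) : (F : A) ^ n * u * (↑F⁻¹ : A) ^ n =
    ∑ i ∈ Finset.range (n + 1), (n.choose i : ℂ) •
      ((adj (F : A) ^ i) u * (↑F⁻¹ : A) ^ i) := by
  rw [pow_mul_eq_sum, Finset.sum_mul]
  refine Finset.sum_congr rfl fun i hi => ?_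
  rw [Finset.mem_range] at hi
  obtain ⟨k, rfl⟩ := Nat.exists_eq_add_of_le (Nat.lt_succ_iff.mp hi)
  rw [Nat.cast_smul_eq_nsmul, smul_mul_assoc, mul_assoc]
  congr 2
  rw [Nat.add_sub_cancel_left, add_comm, pow_add, ← mul_assoc, ← Units.val_pow_eq_pow_val,
   ← Units.val_pow_eq_pow_val, ← Units.val_mul, inv_pow, mul_inv_cancel, Units.val_one, one_mul]

theorem conj_eq_sum' (F : Aˣ) (u : A) (n N : ℕ) (h : (adj (F : A) ^ N) u = 0) :
    (F : A) ^ n * u * (↑F⁻¹ : A) ^ n =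
    ∑ i ∈ Finset.range N, Ring.choose (n : ℂ) i •
      ((adj (F : A) ^ i) u * (↑F⁻¹ : A) ^ i) := by
  rw [conj_eq_sum]
  simp only [Ring.choose_natCast]
  rw [Finset.sum_subset (Finset.range_subset_range.mpr (le_max_left (n + 1) N)),
    ← Finset.sum_subset (Finset.range_subset_range.mpr (le_max_right (n + 1) N))]
  · intro i _ hi
    rw [Finset.mem_range, not_lt] at hi
    rw [ad_pow_of_le h hi, zero_mul, smul_zero]
  · intro i _ hi
    rw [Finset.mem_range, not_lt] at hi
    rw [Nat.choose_eq_zero_of_lt (by omega), Nat.cast_zero, zero_smul]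

/-- The (finite) sum `∑ᵢ (a choose i) (ad F)^i(u) F^{-i}`. -/
noncomputable def phiFun (F : Aˣ) (a : ℂ) (u : A) : A :=
  ∑ᶠ i : ℕ, Ring.choose a i • ((adj (F : A) ^ i) u * (↑F⁻¹ : A) ^ i)

theorem phiFun_eq_sum (F : Aˣ) (a : ℂ) (u : A) {N : ℕ}
    (h : (adj (F : A) ^ N) u = 0) : phiFun F a u =
    ∑ i ∈ Finset.range N, Ring.choose a i •
      ((adj (F : A) ^ i) u * (↑F⁻¹ : A) ^ i) :=
  finsum_eq_of_zero _ fun i hi => by rw [ad_pow_of_le h hi, zero_mul]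

theorem phiFun_mul (F : Aˣ) (hF : ∀ u : A, ∃ n : ℕ, (adj (F : A) ^ n) u = 0)
    (a : ℂ) (u v : A) : phiFun F a (u * v) = phiFun F a u * phiFun F a v := by
  obtain ⟨m, hm⟩ := hF u
  obtain ⟨n, hn⟩ := hF v
  have hmn := ad_pow_mul_eq_zero (F : A) (m + n) m n u v le_rfl hm hn
  rw [phiFun_eq_sum F a u hm, phiFun_eq_sum F a v hn, phiFun_eq_sum F a _ hmn, ← sub_eq_zero,
    ← Module.forall_dual_apply_eq_zero_iff ℂ]
  intro l
  rw [map_sub, sub_eq_zero]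
  simp only [Finset.sum_mul_sum, smul_mul_smul_comm, map_sum, map_smul, smul_eq_mul,
    ← eval_choosePoly, ← Polynomial.eval_mul]
  have key : ∀ x y : Polynomial ℂ, (∀ k : ℕ, x.eval (k : ℂ) = y.eval (k : ℂ)) →
      ∀ a : ℂ, x.eval a = y.eval a := by
    intro x y h a
    rw [Polynomial.eq_of_infinite_eval_eq x y]
    refine Set.Infinite.mono (s := Set.range (fun k : ℕ => (k : ℂ))) ?_
      (Set.infinite_range_of_injective Nat.cast_injective)
    rintro _ ⟨k, rfl⟩
    exact h k
  have e1 := key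
    (∑ i ∈ Finset.range (m + n), (Polynomial.C ((i.factorial : ℂ)⁻¹) * descPochhammer ℂ i) *
      Polynomial.C (l ((adj (F : A) ^ i) (u * v) * (↑F⁻¹ : A) ^ i)))
    (∑ i ∈ Finset.range m, ∑ j ∈ Finset.range n,
      ((Polynomial.C ((i.factorial : ℂ)⁻¹) * descPochhammer ℂ i) *
        (Polynomial.C ((j.factorial : ℂ)⁻¹) * descPochhammer ℂ j)) *
      Polynomial.C (l ((adj (F : A) ^ i) u * (↑F⁻¹ : A) ^ i *
        ((adj (F : A) ^ j) v * (↑F⁻¹ : A) ^ j)))) ?_ a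
  · simpa only [Polynomial.eval_finsetSum, Polynomial.eval_mul, Polynomial.eval_C] using e1
  · intro k
    have e2 : (F : A) ^ k * (u * v) * (↑F⁻¹ : A) ^ k =
        ((F : A) ^ k * u * (↑F⁻¹ : A) ^ k) * ((F : A) ^ k * v * (↑F⁻¹ : A) ^ k) := by
      rw [← Units.val_pow_eq_pow_val, ← Units.val_pow_eq_pow_val, inv_pow]
      simp only [mul_assoc, Units.inv_mul_cancel_left]
    rw [conj_eq_sum' F _ k _ hm, conj_eq_sum' F _ k _ hn, conj_eq_sum' F _ k _ hmn] at e2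
    have e3 := congrArg l e2
    simp only [Finset.sum_mul_sum, smul_mul_smul_comm, map_sum, map_smul, smul_eq_mul,
      ← eval_choosePoly] at e3
    simpa only [Polynomial.eval_finsetSum, Polynomial.eval_mul, Polynomial.eval_C] using e3

/-- The algebra endomorphism `u ↦ ∑ᵢ (a choose i) (ad F)^i(u) F^{-i}` for a unit `F` with locally
nilpotent `ad F`. For `a = s ∈ ℕ` it is `u ↦ F^s u F^{-s}`. -/
noncomputable def phi (F : Aˣ) (hF : ∀ u : A, ∃ n : ℕ, (adj (F : A) ^ n) u = 0)
    (a : ℂ) : A →ₐ[ℂ] A :=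
  AlgHom.ofLinearMap
    { toFun := phiFun F a
      map_add' := by
        intro u v
        obtain ⟨m, hm⟩ := hF u
        obtain ⟨n, hn⟩ := hF v
        have hm' := ad_pow_of_le hm (le_max_left m n)
        have hn' := ad_pow_of_le hn (le_max_right m n)
        rw [phiFun_eq_sum F a _ hm', phiFun_eq_sum F a _ hn',
          phiFun_eq_sum F a _ (N := max m n) (by rw [map_add, hm', hn', add_zero])]
        simp only [map_add, add_mul, smul_add, Finset.sum_add_distrib]
      map_smul' := by
        intro c u
        obtain ⟨m, hm⟩ := hF u
        rw [phiFun_eq_sum F a _ hm, 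
          phiFun_eq_sum F a _ (N := m) (by rw [map_smul, hm, smul_zero])]
        simp only [map_smul, smul_mul_assoc, Finset.smul_sum, RingHom.id_apply]
        exact Finset.sum_congr rfl fun i _ => smul_comm _ _ _ }
    (by
      change phiFun F a 1 = 1
      rw [phiFun_eq_sum F a 1 (N := 1)
        (by simp [adj_apply])]
      simp)
    (phiFun_mul F hF a)

end Phi

/-! ### Lie superalgebras, enveloping algebras, `sl₂`-triples -/

/-- The Koszul sign `(-1)^{ij}`. -/
def koszulSign (i j : ZMod 2) : ℂ := if i = 1 ∧ j = 1 then -1 else 1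

/-- A complex Lie superalgebra: a `ℤ/2`-graded vector space with an even bilinear bracket which is
super skew-symmetric and satisfies the super Jacobi identity. -/
class LieSuperalgebra (𝔤 : Type u) [AddCommGroup 𝔤] [Module ℂ 𝔤] where
  /-- the homogeneous components -/
  gr : ZMod 2 → Submodule ℂ 𝔤
  isInternal : DirectSum.IsInternal gr
  /-- the superbracket -/
  br : 𝔤 →ₗ[ℂ] 𝔤 →ₗ[ℂ] 𝔤
  br_mem : ∀ {i j : ZMod 2} {x y : 𝔤}, x ∈ gr i → y ∈ gr j → br x y ∈ gr (i + j)
  br_skew : ∀ {i j : ZMod 2} {x y : 𝔤}, x ∈ gr i → y ∈ gr j →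
    br x y = -(koszulSign i j • br y x)
  br_jacobi : ∀ {i j : ZMod 2} {x y : 𝔤} (z : 𝔤), x ∈ gr i → y ∈ gr j →
    br x (br y z) = br (br x y) z + koszulSign i j • br y (br x z)

open LieSuperalgebra

section Enveloping

variable (𝔤 : Type u) [AddCommGroup 𝔤] [Module ℂ 𝔤] [LieSuperalgebra 𝔤]

/-- The defining relations `x y - (-1)^{|x||y|} y x = [x, y]` of the universal enveloping
algebra. -/
inductive EnvRel : TensorAlgebra ℂ 𝔤 → TensorAlgebra ℂ 𝔤 → Prop
  | mk {i j : ZMod 2} {x y : 𝔤} (hx : x ∈ gr i) (hy : y ∈ gr j) :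
      EnvRel (TensorAlgebra.ι ℂ x * TensorAlgebra.ι ℂ y)
        (koszulSign i j • (TensorAlgebra.ι ℂ y * TensorAlgebra.ι ℂ x) +
          TensorAlgebra.ι ℂ (br x y))

/-- The universal enveloping algebra `U(𝔤)` of a Lie superalgebra. -/
def Env : Type u := RingQuot (EnvRel 𝔤)

noncomputable instance : Ring (Env 𝔤) := inferInstanceAs (Ring (RingQuot (EnvRel 𝔤)))

noncomputable instance : Algebra ℂ (Env 𝔤) :=
  inferInstanceAs (Algebra ℂ (RingQuot (EnvRel 𝔤)))

/-- The quotient map from the tensor algebra. -/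
noncomputable def envMk : TensorAlgebra ℂ 𝔤 →ₐ[ℂ] Env 𝔤 := RingQuot.mkAlgHom ℂ (EnvRel 𝔤)

variable {𝔤}

/-- The canonical map `𝔤 → U(𝔤)`. -/
noncomputable def envι : 𝔤 →ₗ[ℂ] Env 𝔤 := (envMk 𝔤).toLinearMap ∘ₗ TensorAlgebra.ι ℂ

theorem envι_mul {i j : ZMod 2} {x y : 𝔤} (hx : x ∈ gr i) (hy : y ∈ gr j) :
    envι x * envι y = koszulSign i j • (envι y * envι x) + envι (br x y) := by
  have h : envMk 𝔤 _ = envMk 𝔤 _ := RingQuot.mkAlgHom_rel ℂ (EnvRel.mk hx hy)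
  rw [map_mul, map_add, map_smul, map_mul] at h
  exact h

theorem env_induction {p : Env 𝔤 → Prop} (hc : ∀ c : ℂ, p (algebraMap ℂ _ c))
    (hι : ∀ x : 𝔤, p (envι x)) (hmul : ∀ u v, p u → p v → p (u * v))
    (hadd : ∀ u v, p u → p v → p (u + v)) (u : Env 𝔤) : p u := by
  obtain ⟨w, rfl⟩ := RingQuot.mkAlgHom_surjective ℂ (EnvRel 𝔤) u
  change p (envMk 𝔤 w)
  induction w using TensorAlgebra.induction with
  | algebraMap c => rw [AlgHom.commutes]; exact hc c
  | ι x => exact hι x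
  | mul a b ha hb => rw [map_mul]; exact hmul _ _ ha hb
  | add a b ha hb => rw [map_add]; exact hadd _ _ ha hb

theorem zmod_two_univ : (Set.univ : Set (ZMod 2)) = {0, 1} := by
  ext i
  simp only [Set.mem_univ, Set.mem_insert_iff, Set.mem_singleton_iff, true_iff]
  revert i
  decide

theorem isCompl_of_isInternal {M : Type u} [AddCommGroup M] [Module ℂ M]
    {A : ZMod 2 → Submodule ℂ M} (h : DirectSum.IsInternal A) : IsCompl (A 0) (A 1) :=
  (DirectSum.isInternal_submodule_iff_isCompl A (i := 0) (j := 1) (by decide)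
    zmod_two_univ).mp h

theorem isInternal_of_isCompl {M : Type u} [AddCommGroup M] [Module ℂ M]
    {A : ZMod 2 → Submodule ℂ M} (h : IsCompl (A 0) (A 1)) : DirectSum.IsInternal A :=
  (DirectSum.isInternal_submodule_iff_isCompl A (i := 0) (j := 1) (by decide)
    zmod_two_univ).mpr h

theorem exists_add_of_isInternal {M : Type u} [AddCommGroup M] [Module ℂ M]
    {A : ZMod 2 → Submodule ℂ M} (h : DirectSum.IsInternal A) (v : M) :
    ∃ v₀ ∈ A 0, ∃ v₁ ∈ A 1, v₀ + v₁ = v := by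
  have : v ∈ A 0 ⊔ A 1 := by rw [(isCompl_of_isInternal h).sup_eq_top]; trivial
  exact Submodule.mem_sup.mp this

theorem adj_envι {x : 𝔤} (hx : x ∈ gr (0 : ZMod 2)) (y : 𝔤) :
    adj (envι x) (envι y) = envι (br x y) := by
  have key : ∀ (j : ZMod 2) (y : 𝔤), y ∈ gr j → adj (envι x) (envι y) = envι (br x y) := by
    intro j y hy
    rw [adj_apply, envι_mul hx hy]
    simp [koszulSign]
  obtain ⟨y₀, h₀, y₁, h₁, rfl⟩ := exists_add_of_isInternal isInternal y
  simp only [map_add, key 0 y₀ h₀, key 1 y₁ h₁]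

/-- A subalgebra `sl₂ ⊆ 𝔤` (consisting of even elements) with a fixed standard basis `e, h, f`,
whose adjoint action on `𝔤` is locally finite. As `sl₂` is simple, `h ≠ 0` says that `e, h, f`
are linearly independent. -/
structure LocFinSl2 (𝔤 : Type u) [AddCommGroup 𝔤] [Module ℂ 𝔤] [LieSuperalgebra 𝔤] where
  e : 𝔤
  h : 𝔤
  f : 𝔤
  e_mem : e ∈ gr (0 : ZMod 2)
  h_mem : h ∈ gr (0 : ZMod 2)
  f_mem : f ∈ gr (0 : ZMod 2)
  h_ne_zero : h ≠ 0
  br_h_e : br h e = (2 : ℂ) • e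
  br_h_f : br h f = (-2 : ℂ) • f
  br_e_f : br e f = h
  locFin : ∀ x : 𝔤, ∃ V : Submodule ℂ 𝔤, FiniteDimensional ℂ V ∧ x ∈ V ∧
    ∀ y ∈ V, br e y ∈ V ∧ br h y ∈ V ∧ br f y ∈ V

theorem nilpotent_of_bracket {V : Type u} [AddCommGroup V] [Module ℂ V] [FiniteDimensional ℂ V]
    (H F : Module.End ℂ V) (hHF : H * F - F * H = (-2 : ℂ) • F) : ∃ n : ℕ, F ^ n = 0 := by
  by_contra! hne
  have h1 : ∀ n : ℕ, H * F ^ n - F ^ n * H = (-2 * n : ℂ) • F ^ n := by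
    intro n
    induction n with
    | zero => simp
    | succ n ih =>
      have : H * F ^ (n + 1) - F ^ (n + 1) * H =
          (H * F ^ n - F ^ n * H) * F + F ^ n * (H * F - F * H) := by
        rw [pow_succ]; noncomm_ring
      rw [this, ih, hHF, smul_mul_assoc, mul_smul_comm, ← pow_succ, ← add_smul]
      congr 1
      push_cast; ring
  have h2 : ∀ n : ℕ, (adj H).HasEigenvalue (-2 * n : ℂ) := by
    intro n
    exact Module.End.hasEigenvalue_of_hasEigenvector (x := F ^ n)
      ⟨Module.End.mem_eigenspace_iff.mpr (h1 n), hne n⟩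
  have h3 : Set.Infinite (Set.range fun n : ℕ => (-2 * n : ℂ)) :=
    Set.infinite_range_of_injective fun m n hmn => by simpa using hmn
  refine h3 ((Module.End.finite_hasEigenvalue (adj H)).subset ?_)
  rintro _ ⟨n, rfl⟩
  exact h2 n

namespace LocFinSl2

variable (t : LocFinSl2 𝔤)

theorem ad_f_locNilp (x : 𝔤) : ∃ n : ℕ, (br t.f ^ n) x = 0 := by
  obtain ⟨V, hV, hx, hst⟩ := t.locFin x
  let H : Module.End ℂ V := (br t.h).restrict fun y hy => (hst y hy).2.1
  let F : Module.End ℂ V := (br t.f).restrict fun y hy => (hst y hy).2.2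
  obtain ⟨n, hn⟩ := nilpotent_of_bracket H F (by
    ext y
    have h0 := br_jacobi (y : 𝔤) t.h_mem t.f_mem
    simp only [koszulSign, zero_ne_one, and_self, if_false, one_smul, t.br_h_f] at h0
    change br t.h (br t.f y) - br t.f (br t.h y) = (-2 : ℂ) • br t.f y
    rw [h0, map_smul, LinearMap.smul_apply, add_sub_cancel_right])
  refine ⟨n, ?_⟩
  have h1 : ∀ (k : ℕ) (y : V), ((F ^ k) y : 𝔤) = (br t.f ^ k) y := by
    intro k
    induction k with
    | zero => intro y; rfl
    | succ k ih => intro y; rw [pow_succ, pow_succ, Module.End.mul_apply, ih]; rfl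
  have h2 := h1 n ⟨x, hx⟩
  rw [hn] at h2
  exact h2.symm

theorem adj_f_locNilp (u : Env 𝔤) : ∃ n : ℕ, (adj (envι t.f) ^ n) u = 0 := by
  induction u using env_induction with
  | hc c => exact ⟨1, by simp [adj_apply, Algebra.commutes]⟩
  | hι x =>
    obtain ⟨n, hn⟩ := t.ad_f_locNilp x
    refine ⟨n, ?_⟩
    have : ∀ (k : ℕ) (y : 𝔤), (adj (envι t.f) ^ k) (envι y) = envι ((br t.f ^ k) y) := by
      intro k
      induction k with
      | zero => intro y; rfl
      | succ k ih =>
        intro y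
        rw [pow_succ, pow_succ, Module.End.mul_apply, Module.End.mul_apply, adj_envι t.f_mem, ih]
    rw [this, hn, map_zero]
  | hmul u v hu hv =>
    obtain ⟨m, hm⟩ := hu
    obtain ⟨n, hn⟩ := hv
    exact ⟨m + n, ad_pow_mul_eq_zero _ _ m n u v le_rfl hm hn⟩
  | hadd u v hu hv =>
    obtain ⟨m, hm⟩ := hu
    obtain ⟨n, hn⟩ := hv
    exact ⟨max m n, by rw [map_add, ad_pow_of_le hm (le_max_left m n),
      ad_pow_of_le hn (le_max_right m n), add_zero]⟩

/-- The multiplicative set `{f^s | s ≥ 0}` in `U(𝔤)`. -/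
noncomputable def S : Submonoid (Env 𝔤) := Submonoid.powers (envι t.f)

noncomputable instance : OreLocalization.OreSet t.S :=
  Classical.choice (nonempty_oreSet (envι t.f) t.adj_f_locNilp)

/-- The localized algebra `U(𝔤)[f⁻¹]`. -/
abbrev EnvLoc : Type u := OreLocalization t.S (Env 𝔤)

/-- The element `f ^ k` of the multiplicative set. -/
noncomputable def fS (k : ℕ) : t.S := ⟨envι t.f ^ k, k, rfl⟩

/-- `f` as a unit of `U(𝔤)[f⁻¹]`. -/
noncomputable def fUnit : t.EnvLocˣ := OreLocalization.numeratorUnit (t.fS 1)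

/-- The algebra map `U(𝔤) → U(𝔤)[f⁻¹]`. -/
noncomputable def toLoc : Env 𝔤 →ₐ[ℂ] t.EnvLoc :=
  { (OreLocalization.numeratorRingHom : Env 𝔤 →+* t.EnvLoc) with commutes' := fun _ => rfl }

theorem fUnit_val : (t.fUnit : t.EnvLoc) = t.toLoc (envι t.f) := by
  change t.toLoc (envι t.f ^ 1) = _
  rw [pow_one]

theorem fUnit_pow_val (k : ℕ) : (t.fUnit : t.EnvLoc) ^ k = t.toLoc (envι t.f ^ k) := by
  rw [fUnit_val, map_pow]

theorem one_div_fS (k : ℕ) : (1 : Env 𝔤) /ₒ t.fS k = (↑t.fUnit⁻¹ : t.EnvLoc) ^ k := by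
  have h1 : ((1 : Env 𝔤) /ₒ t.fS k) = ↑(OreLocalization.numeratorUnit (t.fS k))⁻¹ := rfl
  have h2 : OreLocalization.numeratorUnit (t.fS k) = t.fUnit ^ k := by
    ext
    rw [Units.val_pow_eq_pow_val, fUnit_pow_val]
    rfl
  rw [h1, h2, ← inv_pow, Units.val_pow_eq_pow_val]

theorem envLoc_exists (u : t.EnvLoc) : ∃ (k : ℕ) (r : Env 𝔤),
    u = (↑t.fUnit⁻¹ : t.EnvLoc) ^ k * t.toLoc r := by
  induction u using OreLocalization.ind with
  | _ r s =>
    obtain ⟨_, k, rfl⟩ := s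
    refine ⟨k, r, ?_⟩
    rw [← one_div_fS]
    exact (OreLocalization.one_div_mul (t := t.fS k) (s := 1)).symm ▸ by rw [one_mul]; rfl

theorem fUnit_locNilp (u : t.EnvLoc) : ∃ n : ℕ, (adj (t.fUnit : t.EnvLoc) ^ n) u = 0 := by
  obtain ⟨k, r, rfl⟩ := t.envLoc_exists u
  obtain ⟨n, hn⟩ := t.adj_f_locNilp r
  refine ⟨1 + n, ad_pow_mul_eq_zero _ _ 1 n _ _ le_rfl ?_ ?_⟩
  · rw [pow_one, adj_apply, sub_eq_zero]
    exact ((Commute.refl (t.fUnit : t.EnvLoc)).units_inv_right.pow_right k).eq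
  · have : ∀ (m : ℕ) (r : Env 𝔤), (adj (t.fUnit : t.EnvLoc) ^ m) (t.toLoc r) =
        t.toLoc ((adj (envι t.f) ^ m) r) := by
      intro m
      induction m with
      | zero => intro r; rfl
      | succ m ih =>
        intro r
        have h1 : adj (t.fUnit : t.EnvLoc) (t.toLoc r) = t.toLoc (adj (envι t.f) r) := by
          rw [adj_apply, adj_apply, fUnit_val, map_sub, map_mul, map_mul]
        rw [pow_succ, pow_succ, Module.End.mul_apply, Module.End.mul_apply, h1, ih]
    rw [this, hn, map_zero]

/-- The algebra endomorphism `φ_a(u) = ∑ᵢ (a choose i) (ad f)^i(u) f^{-i}` of `U(𝔤)[f⁻¹]`. -/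
noncomputable def φ (a : ℂ) : t.EnvLoc →ₐ[ℂ] t.EnvLoc := phi t.fUnit t.fUnit_locNilp a

theorem φ_eq_sum (a : ℂ) (u : t.EnvLoc) {N : ℕ} (h : (adj (t.fUnit : t.EnvLoc) ^ N) u = 0) :
    t.φ a u = ∑ i ∈ Finset.range N, Ring.choose a i •
      ((adj (t.fUnit : t.EnvLoc) ^ i) u * (↑t.fUnit⁻¹ : t.EnvLoc) ^ i) :=
  phiFun_eq_sum _ _ _ h

end LocFinSl2

end Enveloping

/-! ### Graded modules -/

section Modules

/-- A `𝔤`-module over a Lie superalgebra `𝔤`: a `U(𝔤)`-module with a `ℤ/2`-grading that is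
compatible with the grading of `𝔤`. -/
structure SuperModule (𝔤 : Type u) [AddCommGroup 𝔤] [Module ℂ 𝔤] [LieSuperalgebra 𝔤] where
  carrier : Type u
  [addCommGroup : AddCommGroup carrier]
  [moduleC : Module ℂ carrier]
  [moduleEnv : Module (Env 𝔤) carrier]
  [tower : IsScalarTower ℂ (Env 𝔤) carrier]
  /-- the homogeneous components -/
  gr : ZMod 2 → Submodule ℂ carrier
  isInternal : DirectSum.IsInternal gr
  smul_mem : ∀ {i j : ZMod 2} {x : 𝔤} {v : carrier},
    x ∈ LieSuperalgebra.gr i → v ∈ gr j → (envι x : Env 𝔤) • v ∈ gr (i + j)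

namespace SuperModule

variable {𝔤 : Type u} [AddCommGroup 𝔤] [Module ℂ 𝔤] [LieSuperalgebra 𝔤]

instance : CoeSort (SuperModule 𝔤) (Type u) := ⟨SuperModule.carrier⟩

attribute [instance] addCommGroup moduleC moduleEnv tower

theorem even_smul_mem (N : SuperModule 𝔤) {j : ZMod 2} {x : 𝔤} {v : N}
    (hx : x ∈ LieSuperalgebra.gr (0 : ZMod 2)) (hv : v ∈ N.gr j) :
    (envι x : Env 𝔤) • v ∈ N.gr j := by
  have := N.smul_mem hx hv
  rwa [zero_add] at this

theorem even_pow_smul_mem (N : SuperModule 𝔤) {j : ZMod 2} {x : 𝔤} {v : N}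
    (hx : x ∈ LieSuperalgebra.gr (0 : ZMod 2)) (hv : v ∈ N.gr j) (k : ℕ) :
    (envι x : Env 𝔤) ^ k • v ∈ N.gr j := by
  induction k with
  | zero => rwa [pow_zero, one_smul]
  | succ k ih => rw [pow_succ', mul_smul]; exact N.even_smul_mem hx ih

/-- Homomorphisms of `𝔤`-modules: the space of `U(𝔤)`-linear maps preserving the grading. -/
noncomputable def homSpace (M N : SuperModule 𝔤) : Submodule ℂ (M →ₗ[Env 𝔤] N) where
  carrier := {ψ | ∀ (i : ZMod 2) (v : M), v ∈ M.gr i → ψ v ∈ N.gr i}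
  zero_mem' := fun i _ _ => (N.gr i).zero_mem
  add_mem' := fun hψ hψ' i v hv => (N.gr i).add_mem (hψ i v hv) (hψ' i v hv)
  smul_mem' := fun c _ hψ i v hv => (N.gr i).smul_mem c (hψ i v hv)

/-- The category of `𝔤`-modules. -/
noncomputable instance : Category (SuperModule 𝔤) where
  Hom M N := homSpace M N
  id M := ⟨LinearMap.id, fun _ _ hv => hv⟩
  comp ψ χ := ⟨χ.1 ∘ₗ ψ.1, fun i v hv => χ.2 i _ (ψ.2 i v hv)⟩

/-- The `U(𝔤)`-linear map underlying a morphism. -/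
def Hom.lin {M N : SuperModule 𝔤} (ψ : M ⟶ N) : M →ₗ[Env 𝔤] N := Subtype.val ψ

theorem Hom.lin_mem {M N : SuperModule 𝔤} (ψ : M ⟶ N) {i : ZMod 2} {v : M} (hv : v ∈ M.gr i) :
    Hom.lin ψ v ∈ N.gr i := Subtype.property ψ i v hv

/-- Constructor for morphisms. -/
def Hom.mk {M N : SuperModule 𝔤} (ψ : M →ₗ[Env 𝔤] N)
    (h : ∀ (i : ZMod 2) (v : M), v ∈ M.gr i → ψ v ∈ N.gr i) : M ⟶ N := ⟨ψ, h⟩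

@[simp] theorem Hom.lin_mk {M N : SuperModule 𝔤} (ψ : M →ₗ[Env 𝔤] N)
    (h : ∀ (i : ZMod 2) (v : M), v ∈ M.gr i → ψ v ∈ N.gr i) : Hom.lin (Hom.mk ψ h) = ψ := rfl

@[simp] theorem Hom.lin_id (M : SuperModule 𝔤) : Hom.lin (𝟙 M) = LinearMap.id := rfl

@[simp] theorem Hom.lin_comp {M N P : SuperModule 𝔤} (ψ : M ⟶ N) (χ : N ⟶ P) :
    Hom.lin (ψ ≫ χ) = Hom.lin χ ∘ₗ Hom.lin ψ := rfl

theorem Hom.ext' {M N : SuperModule 𝔤} {ψ χ : M ⟶ N} (h : ∀ v, Hom.lin ψ v = Hom.lin χ v) :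
    ψ = χ := Subtype.ext (LinearMap.ext h)

noncomputable instance : Preadditive (SuperModule 𝔤) where
  homGroup M N := inferInstanceAs (AddCommGroup (homSpace M N))
  add_comp := fun _ _ _ _ _ χ => Hom.ext' fun _ => map_add (Hom.lin χ) _ _
  comp_add := fun _ _ _ _ _ _ => rfl

noncomputable instance : Linear ℂ (SuperModule 𝔤) where
  homModule M N := inferInstanceAs (Module ℂ (homSpace M N))
  smul_comp := fun _ _ _ c ψ χ => Hom.ext' fun v =>
    LinearMap.map_smul_of_tower (Hom.lin χ) c (Hom.lin ψ v)
  comp_smul := fun _ _ _ _ _ _ => rfl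

end SuperModule

end Modules

/-! ### Twisted localization -/

namespace LocFinSl2

variable {𝔤 : Type u} [AddCommGroup 𝔤] [Module ℂ 𝔤] [LieSuperalgebra 𝔤] (t : LocFinSl2 𝔤)

section Localization

variable {N : Type u} [AddCommGroup N] [Module (Env 𝔤) N]

theorem toLoc_smul (u : Env 𝔤) (v : N) :
    t.toLoc u • ((v /ₒ (1 : t.S)) : OreLocalization t.S N) = (u • v) /ₒ (1 : t.S) :=
  OreLocalization.smul_div_one

theorem fS_zero : t.fS 0 = 1 := Subtype.ext (pow_zero _)

theorem oreDiv_fS (v : N) (k : ℕ) : ((v /ₒ t.fS k) : OreLocalization t.S N) =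
    (↑t.fUnit⁻¹ : t.EnvLoc) ^ k • (v /ₒ (1 : t.S)) := by
  rw [← one_div_fS, OreLocalization.one_div_smul, one_mul]

theorem exists_oreDiv (w : OreLocalization t.S N) : ∃ (k : ℕ) (v : N), w = v /ₒ t.fS k := by
  induction w using OreLocalization.ind with
  | _ v s =>
    obtain ⟨_, k, rfl⟩ := s
    exact ⟨k, v, rfl⟩

theorem oreDiv_expand (v : N) (k l : ℕ) : ((v /ₒ t.fS k) : OreLocalization t.S N) =
    (envι t.f ^ l • v) /ₒ t.fS (l + k) := by
  rw [OreLocalization.expand' v (t.fS k) (t.fS l)]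
  congr 1
  exact Subtype.ext (pow_add _ _ _).symm

theorem oreDiv_eq_zero {v : N} {k : ℕ} (h : ((v /ₒ t.fS k) : OreLocalization t.S N) = 0) :
    ∃ l : ℕ, (envι t.f : Env 𝔤) ^ l • v = 0 := by
  rw [OreLocalization.zero_def, eq_comm, OreLocalization.oreDiv_eq_iff] at h
  obtain ⟨⟨_, l, rfl⟩, r, h1, -⟩ := h
  exact ⟨l, h1.trans (smul_zero r)⟩

theorem oreDiv_eq_zero_of {v : N} {k l : ℕ} (h : (envι t.f : Env 𝔤) ^ l • v = 0) :
    ((v /ₒ t.fS k) : OreLocalization t.S N) = 0 := by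
  rw [oreDiv_expand t v k l, h, OreLocalization.zero_oreDiv]

theorem add_oreDiv_fS (v w : N) (k l : ℕ) :
    ((v /ₒ t.fS k) : OreLocalization t.S N) + w /ₒ t.fS l =
      (envι t.f ^ l • v + envι t.f ^ k • w) /ₒ t.fS (l + k) := by
  rw [oreDiv_expand t v k l, oreDiv_expand t w l k, add_comm k l, OreLocalization.add_oreDiv]

theorem finv_smul_oreDiv (v : N) (k l : ℕ) :
    (↑t.fUnit⁻¹ : t.EnvLoc) ^ l • ((v /ₒ t.fS k) : OreLocalization t.S N) =
      v /ₒ t.fS (l + k) := by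
  rw [oreDiv_fS, oreDiv_fS, pow_add, mul_smul]

variable {N' : Type u} [AddCommGroup N'] [Module (Env 𝔤) N']

/-- The map `N[f⁻¹] → N'[f⁻¹]`, `v / f^k ↦ ψ(v) / f^k`, induced by `ψ : N → N'`. -/
noncomputable def locMap (ψ : N →ₗ[Env 𝔤] N') :
    OreLocalization t.S N →ₗ[t.EnvLoc] OreLocalization t.S N' where
  toFun := OreLocalization.liftExpand (fun v s => ψ v /ₒ s) (by
    intro v u s hs
    rw [map_smul]
    exact OreLocalization.expand _ _ _ hs)
  map_add' := by
    intro x y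
    obtain ⟨k, v, rfl⟩ := t.exists_oreDiv x
    obtain ⟨l, w, rfl⟩ := t.exists_oreDiv y
    rw [add_oreDiv_fS]
    simp only [OreLocalization.liftExpand_of]
    rw [add_oreDiv_fS, map_add, map_smul, map_smul]
  map_smul' := by
    intro u x
    induction u using OreLocalization.ind with
    | _ r s =>
      induction x using OreLocalization.ind with
      | _ v s' =>
        obtain ⟨r', s'', h, hh⟩ := OreLocalization.oreDivSMulChar' r v s s'
        rw [hh]
        simp only [OreLocalization.liftExpand_of, RingHom.id_apply]
        rw [OreLocalization.oreDiv_smul_char r (ψ v) s s' r' s'' h, map_smul]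

theorem locMap_oreDiv (ψ : N →ₗ[Env 𝔤] N') (v : N) (s : t.S) :
    t.locMap ψ (v /ₒ s) = ψ v /ₒ s := rfl

variable [Module ℂ N] [IsScalarTower ℂ (Env 𝔤) N]

theorem smul_oreDiv_fS (c : ℂ) (v : N) (k : ℕ) :
    c • ((v /ₒ t.fS k) : OreLocalization t.S N) = (c • v) /ₒ t.fS k := by
  rw [oreDiv_fS, oreDiv_fS, smul_comm, OreLocalization.smul_oreDiv_one]

end Localization

section TwLoc

/-- The space underlying `D_a(N) = U'f^a ⊗ N[f⁻¹]`, which is identified with `N[f⁻¹]` through the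
bijection `w ↦ f^a ⊗ w`. -/
def TwLoc (_ : ℂ) (N : Type u) [AddCommGroup N] [Module (Env 𝔤) N] : Type u :=
  OreLocalization t.S N

variable (a : ℂ) (N : Type u) [AddCommGroup N] [Module ℂ N] [Module (Env 𝔤) N]
  [IsScalarTower ℂ (Env 𝔤) N]

noncomputable instance : AddCommGroup (t.TwLoc a N) :=
  inferInstanceAs (AddCommGroup (OreLocalization t.S N))

noncomputable instance : Module ℂ (t.TwLoc a N) :=
  inferInstanceAs (Module ℂ (OreLocalization t.S N))

/-- In the bimodule `U'f^a` one has `u f^a = f^a φ_{-a}(u)`. Hence `u ∈ U(𝔤)` acts on `D_a(N)` by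
`u (f^a ⊗ w) = f^a ⊗ φ_{-a}(u) w`. -/
noncomputable instance : Module (Env 𝔤) (t.TwLoc a N) :=
  Module.compHom (OreLocalization t.S N)
    (((t.φ (-a)).comp t.toLoc : Env 𝔤 →ₐ[ℂ] t.EnvLoc) : Env 𝔤 →+* t.EnvLoc)

/-- The bijection `N[f⁻¹] → D_a(N)`, `w ↦ f^a ⊗ w`. -/
noncomputable def twist : OreLocalization t.S N ≃ₗ[ℂ] t.TwLoc a N := LinearEquiv.refl ℂ _

variable {N}

theorem smul_twist (u : Env 𝔤) (w : OreLocalization t.S N) :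
    u • t.twist a N w = t.twist a N (t.φ (-a) (t.toLoc u) • w) := rfl

instance : IsScalarTower ℂ (Env 𝔤) (t.TwLoc a N) where
  smul_assoc c u x := by
    obtain ⟨w, rfl⟩ := (t.twist a N).surjective x
    rw [smul_twist, smul_twist, map_smul t.toLoc, map_smul (t.φ (-a)), smul_assoc]
    rfl

variable {N' : Type u} [AddCommGroup N'] [Module ℂ N'] [Module (Env 𝔤) N']
  [IsScalarTower ℂ (Env 𝔤) N']

/-- The map `D_a(N) → D_a(N')`, `f^a ⊗ w ↦ f^a ⊗ ψ(w)`, induced by `ψ : N → N'`. -/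
noncomputable def twLocLin (ψ : N →ₗ[Env 𝔤] N') : t.TwLoc a N →ₗ[Env 𝔤] t.TwLoc a N' where
  toFun x := t.twist a N' (t.locMap ψ ((t.twist a N).symm x))
  map_add' x y := by rw [map_add, map_add, map_add]
  map_smul' u x := by
    obtain ⟨w, rfl⟩ := (t.twist a N).surjective x
    rw [smul_twist, LinearEquiv.symm_apply_apply, LinearEquiv.symm_apply_apply, map_smul]
    rfl

theorem adj_toLoc_envι (x : 𝔤) : adj (t.fUnit : t.EnvLoc) (t.toLoc (envι x)) =
    t.toLoc (envι (br t.f x)) := by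
  rw [← adj_envι t.f_mem, adj_apply, adj_apply, fUnit_val, map_sub, map_mul, map_mul]

theorem adj_pow_toLoc_envι (n : ℕ) : ∀ (x : 𝔤),
    (adj (t.fUnit : t.EnvLoc) ^ n) (t.toLoc (envι x)) = t.toLoc (envι ((br t.f ^ n) x)) := by
  induction n with
  | zero => intro x; rfl
  | succ n ih =>
    intro x
    rw [pow_succ, pow_succ, Module.End.mul_apply, Module.End.mul_apply, adj_toLoc_envι, ih]

end TwLoc

section Graded

variable (N : SuperModule 𝔤)

/-- The grading of `N[f⁻¹]` for which `v / f^k` is homogeneous of the same degree as `v`. -/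
noncomputable def locGr (i : ZMod 2) : Submodule ℂ (OreLocalization t.S N) where
  carrier := {w | ∃ (k : ℕ), ∃ v ∈ N.gr i, w = v /ₒ t.fS k}
  zero_mem' := ⟨0, 0, (N.gr i).zero_mem, (OreLocalization.zero_oreDiv _).symm⟩
  add_mem' := by
    rintro _ _ ⟨k, v, hv, rfl⟩ ⟨l, w, hw, rfl⟩
    exact ⟨l + k, _, (N.gr i).add_mem (N.even_pow_smul_mem t.f_mem hv l)
      (N.even_pow_smul_mem t.f_mem hw k), t.add_oreDiv_fS v w k l⟩
  smul_mem' := by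
    rintro c _ ⟨k, v, hv, rfl⟩
    exact ⟨k, c • v, (N.gr i).smul_mem c hv, t.smul_oreDiv_fS c v k⟩

theorem locGr_isInternal : DirectSum.IsInternal (t.locGr N) := by
  apply isInternal_of_isCompl
  constructor
  · rw [Submodule.disjoint_def]
    rintro w ⟨k, v, hv, rfl⟩ ⟨l, v', hv', h⟩
    have h0 : ((((envι t.f : Env 𝔤) ^ l • v - (envι t.f : Env 𝔤) ^ k • v') /ₒ t.fS (l + k)) :
        OreLocalization t.S N) = 0 := by
      rw [sub_eq_add_neg, ← OreLocalization.add_oreDiv, ← OreLocalization.neg_def,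
        ← oreDiv_expand, add_comm l k, ← oreDiv_expand, h, add_neg_cancel]
    obtain ⟨m, hm⟩ := t.oreDiv_eq_zero h0
    rw [smul_sub, sub_eq_zero] at hm
    have h1 : (envι t.f : Env 𝔤) ^ m • (envι t.f : Env 𝔤) ^ l • v ∈ N.gr 0 :=
      N.even_pow_smul_mem t.f_mem (N.even_pow_smul_mem t.f_mem hv l) m
    have h2 : (envι t.f : Env 𝔤) ^ m • (envι t.f : Env 𝔤) ^ l • v ∈ N.gr 1 := by
      rw [hm]
      exact N.even_pow_smul_mem t.f_mem (N.even_pow_smul_mem t.f_mem hv' k) m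
    have h3 := Submodule.disjoint_def.mp (isCompl_of_isInternal N.isInternal).disjoint _ h1 h2
    rw [smul_smul, ← pow_add] at h3
    exact t.oreDiv_eq_zero_of h3
  · rw [codisjoint_iff, eq_top_iff]
    intro w _
    obtain ⟨k, v, rfl⟩ := t.exists_oreDiv w
    obtain ⟨v₀, h₀, v₁, h₁, rfl⟩ := exists_add_of_isInternal N.isInternal v
    rw [← OreLocalization.add_oreDiv]
    exact Submodule.add_mem_sup ⟨k, v₀, h₀, rfl⟩ ⟨k, v₁, h₁, rfl⟩

variable {N}

theorem finv_smul_mem {i : ZMod 2} {w : OreLocalization t.S N} (hw : w ∈ t.locGr N i) (l : ℕ) :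
    (↑t.fUnit⁻¹ : t.EnvLoc) ^ l • w ∈ t.locGr N i := by
  obtain ⟨k, v, hv, rfl⟩ := hw
  exact ⟨l + k, v, hv, t.finv_smul_oreDiv v k l⟩

theorem toLoc_mul_finv (x : 𝔤) : t.toLoc (envι x) * (↑t.fUnit⁻¹ : t.EnvLoc) =
    ↑t.fUnit⁻¹ * t.toLoc (envι x) +
      ↑t.fUnit⁻¹ * (t.toLoc (envι (br t.f x)) * ↑t.fUnit⁻¹) := by
  rw [← adj_toLoc_envι, adj_apply, sub_mul, mul_sub]
  simp [mul_assoc]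

theorem toLoc_smul_mem {i j : ZMod 2} : ∀ (n : ℕ) {x : 𝔤}, x ∈ LieSuperalgebra.gr i →
    (br t.f ^ n) x = 0 → ∀ {w : OreLocalization t.S N}, w ∈ t.locGr N j →
    t.toLoc (envι x) • w ∈ t.locGr N (i + j) := by
  intro n
  induction n with
  | zero =>
    intro x _ h0 w _
    rw [pow_zero, Module.End.one_apply] at h0
    rw [h0, map_zero, map_zero, zero_smul]
    exact Submodule.zero_mem _
  | succ n ih =>
    rintro x hx h0 _ ⟨k, v, hv, rfl⟩
    induction k with
    | zero => exact ⟨0, _, N.smul_mem hx hv, by rw [fS_zero]; exact t.toLoc_smul _ _⟩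
    | succ k ihk =>
      rw [add_comm k 1, ← finv_smul_oreDiv, pow_one, ← mul_smul, toLoc_mul_finv, add_smul]
      refine Submodule.add_mem _ ?_ ?_
      · rw [mul_smul]
        have := t.finv_smul_mem ihk 1
        rwa [pow_one] at this
      · rw [mul_smul, mul_smul]
        have h1 : (↑t.fUnit⁻¹ : t.EnvLoc) • ((v /ₒ t.fS k) : OreLocalization t.S N) ∈
            t.locGr N j := by
          have := t.finv_smul_mem (N := N) (i := j) ⟨k, v, hv, rfl⟩ 1
          rwa [pow_one] at this
        have hx' : br t.f x ∈ LieSuperalgebra.gr i := by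
          have := br_mem t.f_mem hx
          rwa [zero_add] at this
        have h2 := t.finv_smul_mem (ih hx' (by
          rw [← Module.End.mul_apply, ← pow_succ]; exact h0) h1) 1
        rwa [pow_one] at h2

theorem br_f_pow_mem {i : ZMod 2} {x : 𝔤} (hx : x ∈ LieSuperalgebra.gr i) (k : ℕ) :
    (br t.f ^ k) x ∈ LieSuperalgebra.gr i := by
  induction k with
  | zero => exact hx
  | succ k ih =>
    rw [pow_succ', Module.End.mul_apply]
    have := br_mem t.f_mem ih
    rwa [zero_add] at this

variable (N)

/-- The twisted localization `D_a(N)`. -/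
noncomputable def twLocObj (a : ℂ) : SuperModule 𝔤 where
  carrier := t.TwLoc a N
  gr i := (t.locGr N i).map (t.twist a N).toLinearMap
  isInternal := by
    have h : (fun i => (t.locGr N i).map (t.twist a N).toLinearMap) =
        (t.locGr N : ZMod 2 → Submodule ℂ (OreLocalization t.S N)) := by
      funext i
      exact Submodule.map_id _
    rw [h]
    exact t.locGr_isInternal N
  smul_mem := by
    rintro i j x _ hx ⟨w, hw, rfl⟩
    refine ⟨t.φ (-a) (t.toLoc (envι x)) • w, ?_, rfl⟩
    obtain ⟨n, hn⟩ := t.ad_f_locNilp x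
    rw [t.φ_eq_sum (-a) _ (N := n) (by rw [adj_pow_toLoc_envι, hn, map_zero, map_zero]),
      Finset.sum_smul]
    refine Submodule.sum_mem _ fun k _ => ?_
    rw [smul_assoc, mul_smul, adj_pow_toLoc_envι]
    refine Submodule.smul_mem _ _ ?_
    obtain ⟨m, hm⟩ := t.ad_f_locNilp ((br t.f ^ k) x)
    refine t.toLoc_smul_mem m ?_ hm (t.finv_smul_mem hw k)
    exact t.br_f_pow_mem hx k

/-- The vector `f^a ⊗ (v / 1)` of `D_a(N)`. -/
noncomputable def fpow (a : ℂ) {N : SuperModule 𝔤} (v : N) : t.twLocObj N a := t.twist a N (v /ₒ (1 : t.S))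

variable {N}

/-- The functor `D_a` on morphisms: `f^a ⊗ (v / f^k) ↦ f^a ⊗ (ψ(v) / f^k)`. -/
noncomputable def twLocMap (a : ℂ) {M N : SuperModule 𝔤} (ψ : M ⟶ N) :
    t.twLocObj M a ⟶ t.twLocObj N a :=
  SuperModule.Hom.mk (M := t.twLocObj M a) (N := t.twLocObj N a)
    (t.twLocLin a (SuperModule.Hom.lin ψ)) (by
      rintro i _ ⟨_, ⟨k, v, hv, rfl⟩, rfl⟩
      exact ⟨_, ⟨k, _, SuperModule.Hom.lin_mem ψ hv, rfl⟩, rfl⟩)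

/-- The twisted localization functor `D_a`. -/
noncomputable def twLoc (a : ℂ) : SuperModule 𝔤 ⥤ SuperModule 𝔤 where
  obj N := t.twLocObj N a
  map ψ := t.twLocMap a ψ
  map_id M := by
    apply SuperModule.Hom.ext'
    intro x
    obtain ⟨w, rfl⟩ := (t.twist a M).surjective x
    obtain ⟨k, v, rfl⟩ := t.exists_oreDiv w
    rfl
  map_comp ψ χ := by
    apply SuperModule.Hom.ext'
    intro x
    obtain ⟨w, rfl⟩ := (t.twist a _).surjective x
    obtain ⟨k, v, rfl⟩ := t.exists_oreDiv w
    rfl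

end Graded

end LocFinSl2

/-! ### The Zuckerman functor -/

namespace LocFinSl2

variable {𝔤 : Type u} [AddCommGroup 𝔤] [Module ℂ 𝔤] [LieSuperalgebra 𝔤] (t : LocFinSl2 𝔤)

section Zuckerman

variable {N : Type u} [AddCommGroup N] [Module ℂ N] [Module (Env 𝔤) N]

/-- The subspace `ℂ[e] v`. -/
noncomputable def eSpan (v : N) : Submodule ℂ N :=
  Submodule.span ℂ (Set.range fun n : ℕ => (envι t.e : Env 𝔤) ^ n • v)

theorem mem_eSpan (v : N) : v ∈ t.eSpan v :=
  Submodule.subset_span ⟨0, by simp⟩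

theorem eSpan_le {v : N} {W : Submodule ℂ N} (hv : v ∈ W)
    (hW : ∀ w ∈ W, (envι t.e : Env 𝔤) • w ∈ W) : t.eSpan v ≤ W := by
  refine Submodule.span_le.mpr ?_
  rintro _ ⟨n, rfl⟩
  induction n with
  | zero => simpa using hv
  | succ n ih => simp only [pow_succ', mul_smul]; exact hW _ ih

variable [IsScalarTower ℂ (Env 𝔤) N]

theorem e_smul_mem_eSpan (v : N) : ∀ w ∈ t.eSpan v, (envι t.e : Env 𝔤) • w ∈ t.eSpan v := by
  intro w hw
  induction hw using Submodule.span_induction with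
  | mem x hx =>
    obtain ⟨n, rfl⟩ := hx
    exact Submodule.subset_span ⟨n + 1, by simp only [pow_succ', mul_smul]⟩
  | zero => rw [smul_zero]; exact Submodule.zero_mem _
  | add x y _ _ hx hy => rw [smul_add]; exact Submodule.add_mem _ hx hy
  | smul c x _ hx => rw [smul_comm]; exact Submodule.smul_mem _ _ hx

theorem finite_eSpan_iff (v : N) : FiniteDimensional ℂ (t.eSpan v) ↔
    ∃ W : Submodule ℂ N, FiniteDimensional ℂ W ∧ v ∈ W ∧
      ∀ w ∈ W, (envι t.e : Env 𝔤) • w ∈ W :=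
  ⟨fun h => ⟨t.eSpan v, h, t.mem_eSpan v, t.e_smul_mem_eSpan v⟩, fun ⟨_, _, hv, hst⟩ =>
    Submodule.finiteDimensional_of_le (t.eSpan_le hv hst)⟩

theorem finite_eSpan_add {v w : N} (hv : FiniteDimensional ℂ (t.eSpan v))
    (hw : FiniteDimensional ℂ (t.eSpan w)) : FiniteDimensional ℂ (t.eSpan (v + w)) := by
  rw [finite_eSpan_iff]
  refine ⟨t.eSpan v ⊔ t.eSpan w, inferInstance,
    Submodule.add_mem_sup (t.mem_eSpan v) (t.mem_eSpan w), ?_⟩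
  intro x hx
  obtain ⟨y, hy, z, hz, rfl⟩ := Submodule.mem_sup.mp hx
  rw [smul_add]
  exact Submodule.add_mem_sup (t.e_smul_mem_eSpan v y hy) (t.e_smul_mem_eSpan w z hz)

theorem finite_eSpan_smul (u : Env 𝔤) : ∀ {v : N}, FiniteDimensional ℂ (t.eSpan v) →
    FiniteDimensional ℂ (t.eSpan (u • v)) := by
  induction u using env_induction with
  | hc c =>
    intro v hv
    rw [finite_eSpan_iff]
    refine ⟨t.eSpan v, hv, ?_, t.e_smul_mem_eSpan v⟩
    rw [algebraMap_smul]
    exact Submodule.smul_mem _ _ (t.mem_eSpan v)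
  | hι x =>
    intro v hv
    obtain ⟨V, hV, hx, hst⟩ := t.locFin x
    let B : 𝔤 →ₗ[ℂ] N →ₗ[ℂ] N :=
      (Algebra.lsmul ℂ ℂ N : Env 𝔤 →ₐ[ℂ] Module.End ℂ N).toLinearMap ∘ₗ envι
    have hB : ∀ (y : 𝔤) (w : N), B y w = envι y • w := fun _ _ => rfl
    rw [finite_eSpan_iff]
    refine ⟨Submodule.map₂ B V (t.eSpan v), ?_, ?_, ?_⟩
    · exact Module.Finite.iff_fg.mpr (Submodule.FG.map₂ B (Module.Finite.iff_fg.mp hV)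
        (Module.Finite.iff_fg.mp hv))
    · exact Submodule.apply_mem_map₂ B hx (t.mem_eSpan v)
    · intro w hw
      have hle : Submodule.map₂ B V (t.eSpan v) ≤
          (Submodule.map₂ B V (t.eSpan v)).comap (B t.e) := by
        rw [Submodule.map₂_le]
        intro y hy w hw
        rw [Submodule.mem_comap]
        have h1 : B t.e (B y w) = B (br t.e y) w + B y ((envι t.e : Env 𝔤) • w) := by
          simp only [hB, ← adj_envι t.e_mem, adj_apply, sub_smul, mul_smul]
          abel
        rw [h1]
        exact Submodule.add_mem _ (Submodule.apply_mem_map₂ B (hst y hy).1 hw)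
          (Submodule.apply_mem_map₂ B hy (t.e_smul_mem_eSpan v w hw))
      exact hle hw
  | hmul u u' hu hu' => intro v hv; rw [mul_smul]; exact hu (hu' hv)
  | hadd u u' hu hu' => intro v hv; rw [add_smul]; exact t.finite_eSpan_add (hu hv) (hu' hv)

variable (N) in
/-- The submodule `Γ_e(N) = {v ∈ N | dim ℂ[e] v < ∞}`. -/
noncomputable def gammaSub : Submodule (Env 𝔤) N where
  carrier := {v | FiniteDimensional ℂ (t.eSpan v)}
  zero_mem' := (t.finite_eSpan_iff 0).mpr
    ⟨⊥, inferInstance, Submodule.zero_mem _, fun w hw => by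
      rw [Submodule.mem_bot] at hw; rw [hw, smul_zero]; exact Submodule.zero_mem _⟩
  add_mem' := t.finite_eSpan_add
  smul_mem' := fun u _ hv => t.finite_eSpan_smul u hv

theorem mem_gammaSub {v : N} : v ∈ t.gammaSub N ↔ FiniteDimensional ℂ (t.eSpan v) := Iff.rfl

theorem map_mem_gammaSub {N' : Type u} [AddCommGroup N'] [Module ℂ N'] [Module (Env 𝔤) N']
    [IsScalarTower ℂ (Env 𝔤) N'] (ψ : N →ₗ[ℂ] N')
    (hψ : ∀ w, ψ ((envι t.e : Env 𝔤) • w) = (envι t.e : Env 𝔤) • ψ w)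
    {v : N} (hv : v ∈ t.gammaSub N) : ψ v ∈ t.gammaSub N' := by
  rw [mem_gammaSub] at hv
  rw [mem_gammaSub, finite_eSpan_iff]
  refine ⟨(t.eSpan v).map ψ, inferInstance, Submodule.mem_map_of_mem (t.mem_eSpan v), ?_⟩
  rintro _ ⟨w, hw, rfl⟩
  rw [← hψ]
  exact Submodule.mem_map_of_mem (t.e_smul_mem_eSpan v w hw)

end Zuckerman

section ZuckermanFunctor

variable (N : SuperModule 𝔤)

theorem component_mem_gammaSub {v₀ v₁ : N} (h₀ : v₀ ∈ N.gr 0) (h₁ : v₁ ∈ N.gr 1)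
    (h : v₀ + v₁ ∈ t.gammaSub N) : v₀ ∈ t.gammaSub N ∧ v₁ ∈ t.gammaSub N := by
  have hc := isCompl_of_isInternal N.isInternal
  have key : ∀ w : N, ∃ w₀ ∈ N.gr 0, ∃ w₁ ∈ N.gr 1, w₀ + w₁ = w :=
    exists_add_of_isInternal N.isInternal
  let p : N →ₗ[ℂ] N := (N.gr 0).subtype ∘ₗ Submodule.projectionOnto _ _ hc
  have hp : ∀ {w₀ w₁ : N}, w₀ ∈ N.gr 0 → w₁ ∈ N.gr 1 → p (w₀ + w₁) = w₀ := by
    intro w₀ w₁ hw₀ hw₁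
    rw [map_add]
    simp only [p, LinearMap.comp_apply]
    rw [(Submodule.projectionOnto_apply_eq_zero_iff hc).mpr hw₁,
      Submodule.projectionOnto_apply_left hc ⟨w₀, hw₀⟩]
    simp
  have h2 : v₀ ∈ t.gammaSub N := by
    rw [← hp h₀ h₁]
    refine t.map_mem_gammaSub p ?_ h
    intro w
    obtain ⟨w₀, hw₀, w₁, hw₁, rfl⟩ := key w
    rw [smul_add, hp hw₀ hw₁,
      hp (N.even_smul_mem t.e_mem hw₀) (N.even_smul_mem t.e_mem hw₁)]
  exact ⟨h2, by simpa using Submodule.sub_mem _ h h2⟩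

/-- The Zuckerman functor `Γ_e` on objects. -/
noncomputable def gammaObj : SuperModule 𝔤 where
  carrier := t.gammaSub N
  gr i := (N.gr i).comap ((t.gammaSub N).subtype.restrictScalars ℂ)
  isInternal := by
    have hc := isCompl_of_isInternal N.isInternal
    apply isInternal_of_isCompl
    constructor
    · rw [Submodule.disjoint_def]
      intro v h₀ h₁
      exact Subtype.ext (Submodule.disjoint_def.mp hc.disjoint _ h₀ h₁)
    · rw [codisjoint_iff, eq_top_iff]
      rintro ⟨v, hv⟩ _
      obtain ⟨v₀, h₀, v₁, h₁, rfl⟩ := exists_add_of_isInternal N.isInternal v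
      obtain ⟨m₀, m₁⟩ := t.component_mem_gammaSub N h₀ h₁ hv
      exact Submodule.mem_sup.mpr ⟨⟨v₀, m₀⟩, h₀, ⟨v₁, m₁⟩, h₁, rfl⟩
  smul_mem := fun hx hv => N.smul_mem hx hv

/-- The Zuckerman functor `Γ_e`. -/
noncomputable def gamma : SuperModule 𝔤 ⥤ SuperModule 𝔤 where
  obj N := t.gammaObj N
  map {M N} ψ := SuperModule.Hom.mk (M := t.gammaObj M) (N := t.gammaObj N)
    ((SuperModule.Hom.lin ψ).restrict (fun _ hv => t.map_mem_gammaSub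
      ((SuperModule.Hom.lin ψ).restrictScalars ℂ) (fun w => (SuperModule.Hom.lin ψ).map_smul _ w) hv))
    (fun _ _ hv => SuperModule.Hom.lin_mem ψ hv)
  map_id _ := rfl
  map_comp _ _ := rfl

/-- The inclusion `Γ_e(N) ⊆ N`. -/
noncomputable def gammaι : t.gamma ⟶ 𝟭 (SuperModule 𝔤) where
  app N := SuperModule.Hom.mk (M := t.gammaObj N) (N := N) (t.gammaSub N).subtype
    (fun _ _ hv => hv)
  naturality _ _ _ := rfl

end ZuckermanFunctor

/-! ### The Enright functor -/

section Enright

/-- The Enright functor `C_a = Γ_e ∘ D_a`. -/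
noncomputable def enright (a : ℂ) : SuperModule 𝔤 ⥤ SuperModule 𝔤 := t.twLoc a ⋙ t.gamma

/-- The inclusion `C_a(N) ⊆ D_a(N)`. -/
noncomputable def enrightι (a : ℂ) (N : SuperModule 𝔤) :
    (t.enright a).obj N ⟶ (t.twLoc a).obj N := t.gammaι.app ((t.twLoc a).obj N)

/-- The objects of `M(b)`: `h` acts diagonally with eigenvalues in `b + ℤ`, i.e. the module is
spanned by such eigenvectors. -/
def IsM (b : ℂ) : ObjectProperty (SuperModule 𝔤) := fun N =>
  ∀ v : N, v ∈ Submodule.span ℂ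
    {w : N | ∃ n : ℤ, (envι t.h : Env 𝔤) • w = (b + n : ℂ) • w}

/-- The objects of `M(b)^e`: moreover `e` acts locally nilpotently. -/
def IsMe (b : ℂ) : ObjectProperty (SuperModule 𝔤) := fun N =>
  t.IsM b N ∧ ∀ v : N, ∃ n : ℕ, (envι t.e : Env 𝔤) ^ n • v = 0

variable {N : Type u} [AddCommGroup N] [Module ℂ N] [Module (Env 𝔤) N]
  [IsScalarTower ℂ (Env 𝔤) N]

theorem br_f_h : br t.f t.h = (2 : ℂ) • t.f := by
  rw [br_skew t.f_mem t.h_mem, t.br_h_f]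
  simp [koszulSign]

theorem φ_h (a : ℂ) : t.φ (-a) (t.toLoc (envι t.h)) =
    t.toLoc (envι t.h) - algebraMap ℂ _ (2 * a) := by
  have h1 : adj (t.fUnit : t.EnvLoc) (t.toLoc (envι t.h)) = (2 : ℂ) • (t.fUnit : t.EnvLoc) := by
    rw [adj_toLoc_envι, br_f_h, map_smul, map_smul, fUnit_val]
  have h2 : (adj (t.fUnit : t.EnvLoc) ^ 2) (t.toLoc (envι t.h)) = 0 := by
    rw [pow_two, Module.End.mul_apply, h1, map_smul, adj_apply, sub_self, smul_zero]
  rw [t.φ_eq_sum _ _ h2, Finset.sum_range_succ, Finset.sum_range_one, pow_zero, pow_one, pow_zero,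
    pow_one, h1, Ring.choose_zero_right, Ring.choose_one_right, Module.End.one_apply, one_smul,
    mul_one, smul_mul_assoc, Units.mul_inv, smul_smul, Algebra.algebraMap_eq_smul_one,
    sub_eq_add_neg, ← neg_smul]
  congr 2
  ring

theorem h_smul_oreDiv {c : ℂ} {v : N} (hv : (envι t.h : Env 𝔤) • v = c • v) (k : ℕ) :
    t.toLoc (envι t.h) • ((v /ₒ t.fS k) : OreLocalization t.S N) =
      (c + 2 * k : ℂ) • ((v /ₒ t.fS k) : OreLocalization t.S N) := by
  induction k with
  | zero => rw [fS_zero, toLoc_smul, hv, ← OreLocalization.smul_oreDiv_one]; simp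
  | succ k ih =>
    rw [add_comm k 1, ← finv_smul_oreDiv, pow_one, ← mul_smul, toLoc_mul_finv, br_f_h, map_smul,
      map_smul, ← fUnit_val, smul_mul_assoc, Units.mul_inv, add_smul, mul_smul, ih,
      mul_smul_comm, mul_one, smul_assoc, smul_comm, ← add_smul]
    congr 1
    push_cast
    ring

theorem isM_twLoc {a b : ℂ} (hab : a + b = 0) {N : SuperModule 𝔤} (hN : t.IsM a N) :
    t.IsM b ((t.twLoc a).obj N) := by
  intro x
  obtain ⟨w, rfl⟩ := (t.twist a N).surjective x
  obtain ⟨k, v, rfl⟩ := t.exists_oreDiv w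
  let L : N →ₗ[ℂ] t.TwLoc a N :=
    { toFun := fun v => t.twist a N (v /ₒ t.fS k)
      map_add' := fun v w => by rw [← OreLocalization.add_oreDiv, map_add]
      map_smul' := fun c v => by rw [← smul_oreDiv_fS, map_smul, RingHom.id_apply] }
  have h1 := Submodule.mem_map_of_mem (f := L) (hN v)
  rw [Submodule.map_span] at h1
  refine Submodule.span_mono ?_ h1
  rintro _ ⟨v, ⟨n, hn⟩, rfl⟩
  refine ⟨n + 2 * k, ?_⟩
  change (envι t.h : Env 𝔤) • t.twist a N (v /ₒ t.fS k) = _ • t.twist a N (v /ₒ t.fS k)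
  rw [smul_twist, φ_h, sub_smul, h_smul_oreDiv t hn, algebraMap_smul, ← sub_smul, map_smul]
  congr 1
  push_cast
  linear_combination (-1 : ℂ) * hab

theorem mem_of_sum_mem (W : Submodule (Env 𝔤) N) (b : ℂ) (s : Finset ℤ) : ∀ (w : ℤ → N),
    (∀ n ∈ s, (envι t.h : Env 𝔤) • w n = (b + n : ℂ) • w n) → ∑ n ∈ s, w n ∈ W →
    ∀ n ∈ s, w n ∈ W := by
  classical
  induction s using Finset.induction_on with
  | empty => intro w _ _ n hn; exact absurd hn (Finset.notMem_empty n)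
  | insert m s hm ih =>
    intro w hw hsum
    have h1 : ∑ n ∈ s, ((n : ℂ) - m) • w n ∈ W := by
      have h2 : ∑ n ∈ s, ((n : ℂ) - m) • w n = (envι t.h : Env 𝔤) • (∑ n ∈ insert m s, w n) -
          (algebraMap ℂ (Env 𝔤) (b + m)) • ∑ n ∈ insert m s, w n := by
        rw [Finset.smul_sum, Finset.smul_sum, ← Finset.sum_sub_distrib,
          Finset.sum_insert hm, hw m (Finset.mem_insert_self _ _), algebraMap_smul, sub_self,
          zero_add]
        refine Finset.sum_congr rfl fun n hn => ?_
        rw [hw n (Finset.mem_insert_of_mem hn), algebraMap_smul, ← sub_smul]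
        congr 1
        ring
      rw [h2]
      exact Submodule.sub_mem _ (Submodule.smul_mem _ _ hsum) (Submodule.smul_mem _ _ hsum)
    have h3 : ∀ n ∈ s, w n ∈ W := by
      intro n hn
      have h4 := ih (fun n => ((n : ℂ) - m) • w n) (fun n hn => by
        rw [smul_comm, hw n (Finset.mem_insert_of_mem hn), smul_comm]) h1 n hn
      have h5 : (n : ℂ) - m ≠ 0 := by
        rw [sub_ne_zero]
        intro h
        rw [Int.cast_injective h] at hn
        exact hm hn
      have h6 : w n = algebraMap ℂ (Env 𝔤) ((n : ℂ) - m)⁻¹ • (((n : ℂ) - m) • w n) := by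
        rw [algebraMap_smul, smul_smul, inv_mul_cancel₀ h5, one_smul]
      rw [h6]
      exact Submodule.smul_mem _ _ h4
    intro n hn
    rcases Finset.mem_insert.mp hn with rfl | hn
    · rw [Finset.sum_insert hm] at hsum
      exact (Submodule.add_mem_iff_left _ (Submodule.sum_mem _ h3)).mp hsum
    · exact h3 n hn

theorem exists_sum (b : ℂ) {v : N} (hv : v ∈ Submodule.span ℂ
    {w : N | ∃ n : ℤ, (envι t.h : Env 𝔤) • w = (b + n : ℂ) • w}) :
    ∃ (s : Finset ℤ) (w : ℤ → N), (∀ n, (envι t.h : Env 𝔤) • w n = (b + n : ℂ) • w n) ∧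
      ∑ n ∈ s, w n = v := by
  classical
  induction hv using Submodule.span_induction with
  | mem x hx =>
    obtain ⟨n, hn⟩ := hx
    refine ⟨{n}, fun m => if m = n then x else 0, fun m => ?_, by simp⟩
    dsimp only
    split_ifs with h
    · rw [h, hn]
    · rw [smul_zero, smul_zero]
  | zero => exact ⟨∅, fun _ => 0, fun _ => by rw [smul_zero, smul_zero], by simp⟩
  | add x y _ _ hx hy =>
    obtain ⟨s, w, hw, rfl⟩ := hx
    obtain ⟨s', w', hw', rfl⟩ := hy
    refine ⟨s ∪ s', fun n => (if n ∈ s then w n else 0) + (if n ∈ s' then w' n else 0),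
      fun n => ?_, ?_⟩
    · dsimp only
      split_ifs <;> simp [hw, hw']
    · rw [Finset.sum_add_distrib]
      congr 1
      · rw [← Finset.sum_filter]
        congr 1
        ext n; simp
      · rw [← Finset.sum_filter]
        congr 1
        ext n; simp +contextual
  | smul c x _ hx =>
    obtain ⟨s, w, hw, rfl⟩ := hx
    exact ⟨s, fun n => c • w n, fun n => by rw [smul_comm, hw, smul_comm],
      Finset.smul_sum.symm⟩

theorem exists_e_pow_smul_eq_zero {c : ℂ} {v : N} (hv : (envι t.h : Env 𝔤) • v = c • v)
    (hfin : FiniteDimensional ℂ (t.eSpan v)) : ∃ n : ℕ, (envι t.e : Env 𝔤) ^ n • v = 0 := by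
  by_contra! hne
  have hcomm : (envι t.h : Env 𝔤) * envι t.e = envι t.e * envι t.h + (2 : ℂ) • envι t.e := by
    have h1 := adj_envι t.h_mem t.e
    rw [adj_apply, t.br_h_e, map_smul, sub_eq_iff_eq_add'] at h1
    exact h1
  have h1 : ∀ n : ℕ, (envι t.h : Env 𝔤) • ((envι t.e : Env 𝔤) ^ n • v) =
      (c + 2 * n : ℂ) • ((envι t.e : Env 𝔤) ^ n • v) := by
    intro n
    induction n with
    | zero => simpa using hv
    | succ n ih =>
      rw [pow_succ', mul_smul, ← mul_smul, hcomm, add_smul, mul_smul, ih, smul_assoc, smul_comm,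
        ← add_smul]
      congr 1
      push_cast
      ring
  have h2 : LinearIndependent ℂ fun n : ℕ => (envι t.e : Env 𝔤) ^ n • v :=
    Module.End.eigenvectors_linearIndependent' (Algebra.lsmul ℂ ℂ N (envι t.h : Env 𝔤))
      (fun n : ℕ => (c + 2 * n : ℂ)) (fun m n hmn => by simpa using hmn) _
      (fun n => ⟨Module.End.mem_eigenspace_iff.mpr (h1 n), hne n⟩)
  have h3 : LinearIndependent ℂ fun n : ℕ =>
      (⟨(envι t.e : Env 𝔤) ^ n • v, Submodule.subset_span ⟨n, rfl⟩⟩ : t.eSpan v) :=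
    LinearIndependent.of_comp (t.eSpan v).subtype h2
  exact Set.infinite_univ (Set.finite_univ_iff.mpr h3.finite)

theorem mem_span_of_submodule (W : Submodule (Env 𝔤) N) (b : ℂ) (v : W)
    (hv : (v : N) ∈ Submodule.span ℂ
      {w : N | ∃ n : ℤ, (envι t.h : Env 𝔤) • w = (b + n : ℂ) • w}) :
    v ∈ Submodule.span ℂ {w : W | ∃ n : ℤ, (envι t.h : Env 𝔤) • w = (b + n : ℂ) • w} := by
  obtain ⟨s, w, hw, hs⟩ := t.exists_sum b hv
  have hmem := t.mem_of_sum_mem W b s w (fun n _ => hw n) (hs ▸ v.2)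
  have h1 : v = ∑ n ∈ s.attach, (⟨w n, hmem n n.2⟩ : W) := by
    apply Subtype.ext
    rw [← hs, AddSubmonoidClass.coe_finsetSum]
    exact (Finset.sum_attach s w).symm
  rw [h1]
  exact Submodule.sum_mem _ fun n _ => Submodule.subset_span ⟨n, Subtype.ext (hw n)⟩

theorem e_locNilp_gammaSub (b : ℂ) (v : t.gammaSub N)
    (hv : v ∈ Submodule.span ℂ
      {w : t.gammaSub N | ∃ n : ℤ, (envι t.h : Env 𝔤) • w = (b + n : ℂ) • w}) :
    ∃ n : ℕ, (envι t.e : Env 𝔤) ^ n • v = 0 := by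
  induction hv using Submodule.span_induction with
  | mem x hx =>
    obtain ⟨n, hn⟩ := hx
    obtain ⟨k, hk⟩ := t.exists_e_pow_smul_eq_zero (congrArg Subtype.val hn) x.2
    exact ⟨k, Subtype.ext hk⟩
  | zero => exact ⟨0, smul_zero _⟩
  | add x y _ _ hx hy =>
    obtain ⟨m, hm⟩ := hx
    obtain ⟨n, hn⟩ := hy
    refine ⟨m + n, ?_⟩
    rw [smul_add, pow_add, mul_smul _ _ y, hn, smul_zero, add_zero, ← pow_add, add_comm, pow_add,
      mul_smul, hm, smul_zero]
  | smul c x _ hx =>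
    obtain ⟨n, hn⟩ := hx
    exact ⟨n, by rw [smul_comm, hn, smul_zero]⟩

/-- `C_a` maps `M(a)` to `M(-a)^e`. -/
theorem isMe_enright {a b : ℂ} (hab : a + b = 0) {N : SuperModule 𝔤} (hN : t.IsM a N) :
    t.IsMe b ((t.enright a).obj N) := by
  have key : t.IsM b ((t.enright a).obj N) := fun v =>
    t.mem_span_of_submodule (t.gammaSub (t.twLocObj N a)) b v (t.isM_twLoc hab hN v.1)
  exact ⟨key, fun v => t.e_locNilp_gammaSub b v (key v)⟩

/-- The restricted Enright functor `C_a : M(a)^e ⥤ M(b)^e` for `b = -a`. -/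
noncomputable def enrightRes {a b : ℂ} (hab : a + b = 0) :
    (t.IsMe a).FullSubcategory ⥤ (t.IsMe b).FullSubcategory :=
  (t.IsMe b).lift ((t.IsMe a).ι ⋙ t.enright a) fun N => t.isMe_enright hab N.property.1

/-- The space `N^f = {v ∈ N | f^s v = 0 for s ≫ 0}`. -/
def fNil (N : SuperModule 𝔤) : Set N :=
  {v | ∃ s₀ : ℕ, ∀ s ≥ s₀, (envι t.f : Env 𝔤) ^ s • v = 0}

end Enright

end LocFinSl2
end TwistedLocalization

open TwistedLocalization

namespace TwistedLocalization

open LieSuperalgebra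

namespace LocFinSl2

variable {𝔤 : Type u} [AddCommGroup 𝔤] [Module ℂ 𝔤] [LieSuperalgebra 𝔤] (t : LocFinSl2 𝔤)

/-! ### The Casimir element of `sl₂` and vectors on which `e` and `f` are nilpotent -/

section Casimir

/-! Let z be the Casimir element. On a vector of weight c, the operator f^p e^p is the product of z
- λ(λ+2)/4 over λ = c, c+2, ..., c+2p-2 (`f_pow_e_pow_smul`). Two consequences carry the theorem.

Rigidity (`eq_zero_of_f_pow_smul_eq_zero`): a vector of non-integral weight killed by powers of both
e and f is zero. The last nonzero f^k v would be a lowest weight vector, so an eigenvector of z, and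
its eigenvalue can be a root of the polynomial above only if the weight is an integer.

Abundance (`exists_fpow_mem_gammaSub`): for v in a module of M(a)^e, some f^a ⊗ f^k v lies in C_a.
If e^m v = 0, a polynomial in z kills v, and it still kills f^a ⊗ f^k v because z commutes with f.
As λ(λ+2) is symmetric under λ ↦ -λ-2, for suitable k this polynomial divides the one attached to
the new weight and some exponent q. Hence f^q e^q kills the vector, and so does e^q, since f is
injective on D_a.

For (i), φ_a and φ_{-a} are mutually inverse, so v ↦ f^{-a} ⊗ (f^a ⊗ v) is U(𝔤)-linear. Its value
equals f^{-a} ⊗ f^{-k}(f^a ⊗ f^k v), which by abundance comes from D_{-a}C_a, and it is e-nilpotent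
because v is. For (ii), the kernel and cokernel of Φ are f-torsion and e-locally nilpotent with
non-integral weights, so they vanish by rigidity; C_{-a} is then a quasi-inverse. For (iii), maps
that agree after C_0 agree on f^k v up to f-torsion, and the target has none. -/

theorem e_mul_f : (envι t.e : Env 𝔤) * envι t.f = envι t.f * envι t.e + envι t.h := by
  have h1 := adj_envι t.e_mem t.f
  rwa [adj_apply, t.br_e_f, sub_eq_iff_eq_add'] at h1

theorem h_mul_e :
    (envι t.h : Env 𝔤) * envι t.e = envι t.e * envι t.h + (2 : ℂ) • envι t.e := by
  have h1 := adj_envι t.h_mem t.e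
  rwa [adj_apply, t.br_h_e, map_smul, sub_eq_iff_eq_add'] at h1

theorem f_mul_h :
    (envι t.f : Env 𝔤) * envι t.h = envι t.h * envι t.f + (2 : ℂ) • envι t.f := by
  have h1 := adj_envι t.f_mem t.h
  rwa [adj_apply, t.br_f_h, map_smul, sub_eq_iff_eq_add'] at h1

/-- The Casimir element `f e + h² / 4 + h / 2` of `U(sl₂)`. -/
noncomputable def casimir : Env 𝔤 :=
  envι t.f * envι t.e + (1 / 4 : ℂ) • (envι t.h * envι t.h) + (1 / 2 : ℂ) • envι t.h

theorem commute_f_casimir : Commute (envι t.f : Env 𝔤) t.casimir := by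
  have h1 : (envι t.f : Env 𝔤) * (envι t.h * envι t.h) =
      (envι t.h * envι t.h) * envι t.f + (4 : ℂ) • (envι t.h * envι t.f) +
        (4 : ℂ) • envι t.f := by
    rw [← mul_assoc, f_mul_h, add_mul, mul_assoc, f_mul_h, smul_mul_assoc, f_mul_h, mul_add,
      mul_smul_comm, smul_add, smul_smul, mul_assoc]
    module
  rw [commute_iff_eq, casimir, mul_add, mul_add, add_mul, add_mul, mul_smul_comm, mul_smul_comm,
    smul_mul_assoc, smul_mul_assoc, h1, f_mul_h, mul_assoc (envι t.f) (envι t.e), e_mul_f, mul_add,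
    f_mul_h]
  module

variable {X : Type u} [AddCommGroup X] [Module ℂ X] [Module (Env 𝔤) X] [IsScalarTower ℂ (Env 𝔤) X]

theorem h_smul_e_pow_smul {c : ℂ} {v : X} (hv : (envι t.h : Env 𝔤) • v = c • v) (n : ℕ) :
    (envι t.h : Env 𝔤) • ((envι t.e : Env 𝔤) ^ n • v) =
      (c + 2 * n) • ((envι t.e : Env 𝔤) ^ n • v) := by
  induction n with
  | zero => simpa using hv
  | succ n ih =>
    rw [pow_succ', mul_smul, ← mul_smul, h_mul_e, add_smul, mul_smul, ih, smul_assoc, smul_comm,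
      ← add_smul]
    congr 1
    push_cast
    ring

theorem h_smul_f_pow_smul {c : ℂ} {v : X} (hv : (envι t.h : Env 𝔤) • v = c • v) (n : ℕ) :
    (envι t.h : Env 𝔤) • ((envι t.f : Env 𝔤) ^ n • v) =
      (c - 2 * n) • ((envι t.f : Env 𝔤) ^ n • v) := by
  induction n with
  | zero => simpa using hv
  | succ n ih =>
    rw [pow_succ', mul_smul, ← mul_smul, ← sub_eq_iff_eq_add.mpr t.f_mul_h, sub_smul, mul_smul,
      ih, smul_assoc, smul_comm, ← sub_smul]
    congr 1
    push_cast
    ring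

/-- The polynomial whose value at the Casimir element is the action of `f^p e^p` on vectors of
weight `c`. -/
noncomputable def casimirPoly (c : ℂ) (p : ℕ) : Polynomial ℂ :=
  ∏ j ∈ Finset.range p, (Polynomial.X - Polynomial.C ((c + 2 * j) * (c + 2 * j + 2) / 4))

theorem casimir_smul {c : ℂ} {v : X} (hv : (envι t.h : Env 𝔤) • v = c • v) :
    t.casimir • v = (envι t.f * envι t.e : Env 𝔤) • v + (c * (c + 2) / 4) • v := by
  rw [casimir, add_smul, add_smul, smul_assoc, smul_assoc, mul_smul (envι t.h), hv,
    smul_comm (envι t.h) c v, hv, smul_smul, smul_smul, smul_smul, add_assoc, ← add_smul]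
  congr 2
  ring

/-- The innermost f e acts on e^p v, of weight c + 2p, as the Casimir element minus a scalar. The
Casimir element then moves past f^p, so each step contributes one more factor. -/
theorem f_pow_e_pow_smul {c : ℂ} {v : X} (hv : (envι t.h : Env 𝔤) • v = c • v) (p : ℕ) :
    (envι t.f : Env 𝔤) ^ p • (envι t.e : Env 𝔤) ^ p • v =
      Polynomial.aeval t.casimir (casimirPoly c p) • v := by
  induction p with
  | zero => simp [casimirPoly]
  | succ p ih =>
    have h1 := t.casimir_smul (t.h_smul_e_pow_smul hv p)
    rw [← sub_eq_iff_eq_add] at h1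
    rw [casimirPoly, Finset.prod_range_succ, mul_comm, ← casimirPoly, map_mul, mul_smul, ← ih,
      pow_succ, pow_succ' (envι t.e), mul_smul, mul_smul (envι t.e), ← mul_smul (envι t.f), ← h1,
      map_sub, Polynomial.aeval_X, Polynomial.aeval_C, sub_smul, algebraMap_smul, smul_sub,
      smul_comm (envι t.f ^ p) (_ : ℂ), ← mul_smul, ← mul_smul t.casimir,
      (t.commute_f_casimir.pow_left p).eq]

/-- A vector of non-integral weight on which `e` and `f` act nilpotently vanishes. -/
theorem eq_zero_of_f_smul_eq_zero {c : ℂ} (hc : ¬ ∃ n : ℤ, c = n) {v : X}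
    (hv : (envι t.h : Env 𝔤) • v = c • v) {p : ℕ} (he : (envι t.e : Env 𝔤) ^ p • v = 0)
    (hf : (envι t.f : Env 𝔤) • v = 0) : v = 0 := by
  -- From f v = 0 one gets f e v = -h v, so v is a Casimir eigenvector.
  have h1 : t.casimir • v = ((c - 2) * c / 4) • v := by
    rw [t.casimir_smul hv, ← sub_eq_iff_eq_add.mpr t.e_mul_f, sub_smul, mul_smul, hf, smul_zero,
      zero_sub, hv, ← neg_smul, ← add_smul]
    congr 1
    ring
  have h2 : ∀ P : Polynomial ℂ,
      Polynomial.aeval t.casimir P • v = P.eval ((c - 2) * c / 4) • v := by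
    intro P
    induction P using Polynomial.induction_on' with
    | add P Q hP hQ => rw [map_add, add_smul, hP, hQ, Polynomial.eval_add, add_smul]
    | monomial n r =>
      rw [Polynomial.aeval_monomial, Polynomial.eval_monomial, mul_smul, mul_smul,
        algebraMap_smul]
      congr 1
      induction n with
      | zero => simp
      | succ n ih => rw [pow_succ, mul_smul, h1, smul_comm, ih, smul_smul, pow_succ']
  have h3 := t.f_pow_e_pow_smul hv p
  rw [he, smul_zero, h2, eq_comm, smul_eq_zero] at h3
  refine h3.resolve_left fun h0 => ?_
  rw [casimirPoly, Polynomial.eval_prod, Finset.prod_eq_zero_iff] at h0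
  obtain ⟨j, -, hj⟩ := h0
  rw [Polynomial.eval_sub, Polynomial.eval_X, Polynomial.eval_C] at hj
  -- c(c-2) - (c+2j)(c+2j+2) = -4(j+1)(c+j), so a vanishing factor forces c = -j.
  have h4 : ((j : ℂ) + 1) * (c + j) = 0 := by linear_combination (-1 : ℂ) * hj
  rcases mul_eq_zero.mp h4 with h5 | h5
  · exact Nat.cast_add_one_ne_zero j h5
  · exact hc ⟨-j, by push_cast; linear_combination h5⟩

theorem mem_gammaSub_of_e_pow_smul {v : X} {p : ℕ} (he : (envι t.e : Env 𝔤) ^ p • v = 0) :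
    v ∈ t.gammaSub X := by
  rw [mem_gammaSub, finite_eSpan_iff]
  -- The bound p + 1, rather than p, keeps v itself among the generators when p = 0.
  refine ⟨Submodule.span ℂ ((fun n : ℕ => (envι t.e : Env 𝔤) ^ n • v) '' Set.Iio (p + 1)),
    FiniteDimensional.span_of_finite ℂ ((Set.finite_Iio _).image _),
    Submodule.subset_span ⟨0, Nat.succ_pos p, by simp⟩, fun w hw => ?_⟩
  induction hw using Submodule.span_induction with
  | mem x hx =>
    obtain ⟨n, hn, rfl⟩ := hx
    dsimp only
    rw [← mul_smul, ← pow_succ']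
    rcases Nat.lt_or_ge n p with h | h
    · exact Submodule.subset_span ⟨n + 1, Nat.succ_lt_succ h, rfl⟩
    · obtain ⟨k, hk⟩ : ∃ k, n + 1 = p + k := Nat.exists_eq_add_of_le (Nat.le_succ_of_le h)
      rw [hk, add_comm p k, pow_add, mul_smul, he, smul_zero]
      exact Submodule.zero_mem _
  | zero => rw [smul_zero]; exact Submodule.zero_mem _
  | add x y _ _ hx hy => rw [smul_add]; exact Submodule.add_mem _ hx hy
  | smul c x _ hx => rw [smul_comm]; exact Submodule.smul_mem _ _ hx

/-- Descent on k: f^k v again has non-integral weight. It stays e-nilpotent because `gammaSub` is a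
submodule over all of `Env 𝔤` and its weight vectors are killed by a power of e. -/
theorem eq_zero_of_f_pow_smul_eq_zero {c : ℂ} (hc : ¬ ∃ n : ℤ, c = n) {v : X}
    (hv : (envι t.h : Env 𝔤) • v = c • v) {p k : ℕ} (he : (envι t.e : Env 𝔤) ^ p • v = 0)
    (hf : (envι t.f : Env 𝔤) ^ k • v = 0) : v = 0 := by
  induction k with
  | zero => simpa using hf
  | succ k ih =>
    have h1 := t.h_smul_f_pow_smul hv k
    obtain ⟨q, hq⟩ := t.exists_e_pow_smul_eq_zero h1
      ((t.gammaSub X).smul_mem _ (t.mem_gammaSub_of_e_pow_smul he))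
    refine ih (t.eq_zero_of_f_smul_eq_zero ?_ h1 hq ?_)
    · rintro ⟨n, hn⟩
      exact hc ⟨n + 2 * k, by push_cast; linear_combination hn⟩
    · rwa [pow_succ', mul_smul] at hf

/-- If `c + c' = -2m - 2s`, then the factors of `casimirPoly c m` are the last `m` factors of
`casimirPoly c' (s + m)`, in reverse order. -/
theorem casimirPoly_dvd (c c' : ℂ) (m s : ℕ) (h : c + c' + 2 * m + 2 * s = 0) :
    casimirPoly c m ∣ casimirPoly c' (s + m) := by
  refine Dvd.intro_left (casimirPoly c' s) ?_
  rw [casimirPoly, casimirPoly, casimirPoly, Finset.prod_range_add]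
  congr 1
  -- λ(λ+2) is invariant under λ ↦ -λ-2, which sends c + 2j to c' + 2(s+m-1-j); after reversing one
  -- product the factors match termwise.
  rw [← Finset.prod_range_reflect]
  refine Finset.prod_congr rfl fun j hj => ?_
  rw [Finset.mem_range] at hj
  obtain ⟨i, rfl⟩ := Nat.exists_eq_add_of_lt hj
  rw [show j + i + 1 - 1 - j = i by omega]
  congr 3
  push_cast at h ⊢
  obtain rfl : c' = -c - 2 * (j + i + 1) - 2 * s := by linear_combination h
  ring

end Casimir

end LocFinSl2

/-! ### Opposite twists are mutually inverse -/

theorem adj_pow_mul_inv_pow {A : Type u} [Ring A] [Algebra ℂ A] (F : Aˣ) (u : A) (i j : ℕ) :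
    (adj (F : A) ^ i) ((adj (F : A) ^ j) u * (↑F⁻¹ : A) ^ j) =
      (adj (F : A) ^ (i + j)) u * (↑F⁻¹ : A) ^ j := by
  rw [ad_pow_mul_right _ _ _ ((Commute.refl (F : A)).units_inv_right.pow_right j), pow_add,
    Module.End.mul_apply]

/-- As ad F commutes with right multiplication by F⁻¹, the double sum depends on (i, j) only through
i + j, up to binomial coefficients. Vandermonde's identity collapses the n-th diagonal to the
coefficient (0 choose n). -/
theorem phiFun_phiFun {A : Type u} [Ring A] [Algebra ℂ A] (F : Aˣ)
    (hF : ∀ u : A, ∃ n : ℕ, (adj (F : A) ^ n) u = 0) {a b : ℂ} (hab : a + b = 0) (u : A) :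
    phiFun F a (phiFun F b u) = u := by
  obtain ⟨N, hN⟩ := hF u
  have h0 : (adj (F : A) ^ N) (phiFun F b u) = 0 := by
    rw [phiFun_eq_sum F b u hN, map_sum]
    refine Finset.sum_eq_zero fun j _ => ?_
    rw [map_smul, adj_pow_mul_inv_pow, ad_pow_of_le hN (Nat.le_add_right N j), zero_mul, smul_zero]
  have key : ∀ i j : ℕ, Ring.choose a i • ((adj (F : A) ^ i) (Ring.choose b j •
      ((adj (F : A) ^ j) u * (↑F⁻¹ : A) ^ j)) * (↑F⁻¹ : A) ^ i) =
      (Ring.choose a i * Ring.choose b j) •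
        ((adj (F : A) ^ (i + j)) u * (↑F⁻¹ : A) ^ (i + j)) := by
    intro i j
    rw [map_smul, adj_pow_mul_inv_pow, smul_mul_assoc, smul_smul, mul_assoc, ← pow_add, add_comm j]
  rw [phiFun_eq_sum F a _ h0, phiFun_eq_sum F b u hN]
  simp only [map_sum, Finset.sum_mul, Finset.smul_sum, key]
  -- Terms with i + j ≥ N vanish, so the square of indices shrinks to a triangle that can be summed
  -- along diagonals.
  have h1 : ∀ i ∈ Finset.range N, (∑ j ∈ Finset.range N,
      (Ring.choose a i * Ring.choose b j) •
        ((adj (F : A) ^ (i + j)) u * (↑F⁻¹ : A) ^ (i + j))) =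
      ∑ j ∈ Finset.range (N - i), (Ring.choose a i * Ring.choose b j) •
        ((adj (F : A) ^ (i + j)) u * (↑F⁻¹ : A) ^ (i + j)) := by
    intro i _
    refine (Finset.sum_subset (Finset.range_subset_range.mpr (N.sub_le i)) fun j _ hj => ?_).symm
    rw [Finset.mem_range, not_lt] at hj
    rw [ad_pow_of_le hN (by omega), zero_mul, smul_zero]
  rw [Finset.sum_congr rfl h1, ← Finset.sum_range_diag_flip N fun i j =>
    (Ring.choose a i * Ring.choose b j) • ((adj (F : A) ^ (i + j)) u * (↑F⁻¹ : A) ^ (i + j))]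
  have h2 : ∀ n ∈ Finset.range N, (∑ k ∈ Finset.range (n + 1),
      (Ring.choose a k * Ring.choose b (n - k)) •
        ((adj (F : A) ^ (k + (n - k))) u * (↑F⁻¹ : A) ^ (k + (n - k)))) =
      if n = 0 then u else 0 := by
    intro n _
    have h3 : ∀ k ∈ Finset.range (n + 1), (Ring.choose a k * Ring.choose b (n - k)) •
        ((adj (F : A) ^ (k + (n - k))) u * (↑F⁻¹ : A) ^ (k + (n - k))) =
        (Ring.choose a k * Ring.choose b (n - k)) • ((adj (F : A) ^ n) u * (↑F⁻¹ : A) ^ n) := by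
      intro k hk
      rw [Nat.add_sub_of_le (Nat.lt_succ_iff.mp (Finset.mem_range.mp hk))]
    rw [Finset.sum_congr rfl h3, ← Finset.sum_smul,
      ← Finset.Nat.sum_antidiagonal_eq_sum_range_succ fun i j => Ring.choose a i * Ring.choose b j,
      ← Ring.add_choose_eq n (Commute.all a b), hab, Ring.choose_zero_ite]
    split_ifs with h
    · subst h; simp
    · rw [zero_smul]
  rw [Finset.sum_congr rfl h2, Finset.sum_ite_eq' (Finset.range N) 0 fun _ => u]
  split_ifs with h
  · rfl
  -- For N = 0 the sum is empty, but then `hN` itself says u = 0.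
  · obtain rfl : N = 0 := by simpa using h
    simpa using hN.symm

namespace LocFinSl2

variable {𝔤 : Type u} [AddCommGroup 𝔤] [Module ℂ 𝔤] [LieSuperalgebra 𝔤] (t : LocFinSl2 𝔤)

theorem φ_φ {a b : ℂ} (hab : a + b = 0) (u : t.EnvLoc) : t.φ a (t.φ b u) = u :=
  phiFun_phiFun t.fUnit t.fUnit_locNilp hab u

theorem φ_of_commute (a : ℂ) {u : t.EnvLoc} (hu : Commute (t.fUnit : t.EnvLoc) u) :
    t.φ a u = u := by
  rw [t.φ_eq_sum a u (N := 1) (by rw [pow_one, adj_apply, hu.eq, sub_self])]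
  simp

theorem φ_toLoc_of_commute (a : ℂ) {u : Env 𝔤} (hu : Commute (envι t.f) u) :
    t.φ a (t.toLoc u) = t.toLoc u :=
  t.φ_of_commute a (by rw [fUnit_val]; exact hu.map t.toLoc)

/-! ### The composite D_b D_a for a + b = 0 -/

section DoubleTwist

variable {N : Type u} [AddCommGroup N] [Module ℂ N] [Module (Env 𝔤) N] [IsScalarTower ℂ (Env 𝔤) N]

/-- Powers of f and polynomials in the Casimir element are the elements to which this is applied:
their action is not changed by the twist. -/
theorem smul_twist_of_commute (a : ℂ) {u : Env 𝔤} (hu : Commute (envι t.f) u)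
    (w : OreLocalization t.S N) : u • t.twist a N w = t.twist a N (t.toLoc u • w) := by
  rw [smul_twist, φ_toLoc_of_commute t _ hu]

theorem f_pow_smul_twist (a : ℂ) (k : ℕ) (w : OreLocalization t.S N) :
    (envι t.f : Env 𝔤) ^ k • t.twist a N w = t.twist a N ((t.fUnit : t.EnvLoc) ^ k • w) := by
  rw [smul_twist_of_commute t a ((Commute.refl _).pow_right k), fUnit_pow_val]

theorem finv_pow_mul (k : ℕ) : (↑t.fUnit⁻¹ : t.EnvLoc) ^ k * (t.fUnit : t.EnvLoc) ^ k = 1 := by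
  rw [← Units.val_pow_eq_pow_val, ← Units.val_pow_eq_pow_val, inv_pow, Units.inv_mul]

theorem mul_finv_pow (k : ℕ) : (t.fUnit : t.EnvLoc) ^ k * (↑t.fUnit⁻¹ : t.EnvLoc) ^ k = 1 := by
  rw [← Units.val_pow_eq_pow_val, ← Units.val_pow_eq_pow_val, inv_pow, Units.mul_inv]

theorem eq_zero_of_f_pow_smul_twLoc {a : ℂ} {k : ℕ} {x : t.TwLoc a N}
    (h : (envι t.f : Env 𝔤) ^ k • x = 0) : x = 0 := by
  obtain ⟨w, rfl⟩ := (t.twist a N).surjective x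
  rw [f_pow_smul_twist, EmbeddingLike.map_eq_zero_iff] at h
  rw [EmbeddingLike.map_eq_zero_iff, ← one_smul t.EnvLoc w, ← t.finv_pow_mul k, mul_smul, h,
    smul_zero]

/-- `U(𝔤)[f⁻¹]` acts on the localization of `D_a(N)`, which is `D_a(N)` again, through the twisted
action. -/
theorem smul_twist_oreDiv_one (a : ℂ) (y : t.EnvLoc) (w : OreLocalization t.S N) :
    y • ((t.twist a N w /ₒ (1 : t.S)) : OreLocalization t.S (t.TwLoc a N)) =
      t.twist a N (t.φ (-a) y • w) /ₒ (1 : t.S) := by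
  obtain ⟨k, r, rfl⟩ := t.envLoc_exists y
  have h1 : t.φ (-a) ((↑t.fUnit⁻¹ : t.EnvLoc) ^ k) = (↑t.fUnit⁻¹ : t.EnvLoc) ^ k :=
    t.φ_of_commute _ ((Commute.refl (t.fUnit : t.EnvLoc)).units_inv_right.pow_right k)
  rw [mul_smul, toLoc_smul, smul_twist, map_mul, h1]
  set w' := t.φ (-a) (t.toLoc r) • w with hw'
  -- Writing w' = f^k f^{-k} w' lets f^k leave the twist and cancel the outer f^{-k}.
  rw [mul_smul, ← hw', ← one_smul t.EnvLoc w', ← t.mul_finv_pow k, mul_smul, ← f_pow_smul_twist,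
    ← toLoc_smul, ← fUnit_pow_val, ← mul_smul (_ ^ k) (_ ^ k), finv_pow_mul, one_smul,
    ← mul_smul (_ ^ k) (_ ^ k), finv_pow_mul, one_smul]

variable (N) in
/-- The bijection `N[f⁻¹] → D_b(D_a(N))`, `w ↦ f^b ⊗ (f^a ⊗ w)`. -/
noncomputable def twistTwist (a b : ℂ) (w : OreLocalization t.S N) :
    t.TwLoc b (t.TwLoc a N) :=
  t.twist b (t.TwLoc a N) (t.twist a N w /ₒ (1 : t.S))

/-- The two twists compose to φ_{-a} φ_{-b} = id, so D_b D_a(N) carries the untwisted action of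
N[f⁻¹]. -/
theorem smul_twistTwist {a b : ℂ} (hba : b + a = 0) (u : Env 𝔤) (w : OreLocalization t.S N) :
    u • t.twistTwist N a b w = t.twistTwist N a b (t.toLoc u • w) := by
  rw [twistTwist, smul_twist, smul_twist_oreDiv_one,
    t.φ_φ (by linear_combination (-1 : ℂ) * hba)]
  rfl

theorem twistTwist_add (a b : ℂ) (w w' : OreLocalization t.S N) :
    t.twistTwist N a b (w + w') = t.twistTwist N a b w + t.twistTwist N a b w' := by
  rw [twistTwist, map_add, ← OreLocalization.add_oreDiv, map_add]
  rfl

theorem eq_zero_of_twistTwist_eq_zero {a b : ℂ} {w : OreLocalization t.S N}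
    (h : t.twistTwist N a b w = 0) : w = 0 := by
  rw [twistTwist, EmbeddingLike.map_eq_zero_iff, ← fS_zero] at h
  obtain ⟨l, hl⟩ := t.oreDiv_eq_zero h
  exact (t.twist a N).map_eq_zero_iff.mp (t.eq_zero_of_f_pow_smul_twLoc hl)

theorem twistTwist_surjective (a b : ℂ) : Function.Surjective (t.twistTwist N a b) := by
  intro x
  obtain ⟨z, rfl⟩ := (t.twist b _).surjective x
  obtain ⟨k, y, rfl⟩ := t.exists_oreDiv z
  obtain ⟨w, rfl⟩ := (t.twist a N).surjective y
  refine ⟨t.φ (-a) ((↑t.fUnit⁻¹ : t.EnvLoc) ^ k) • w, ?_⟩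
  rw [twistTwist, ← smul_twist_oreDiv_one, oreDiv_fS]

variable (N) in
/-- The `U(𝔤)`-linear map `N → D_b(D_a(N))`, `v ↦ f^b ⊗ (f^a ⊗ v)`, for `b = -a`. -/
noncomputable def twLocUnit {a b : ℂ} (hba : b + a = 0) :
    N →ₗ[Env 𝔤] t.TwLoc b (t.TwLoc a N) where
  toFun v := t.twistTwist N a b (v /ₒ (1 : t.S))
  map_add' v w := by rw [← twistTwist_add, OreLocalization.add_oreDiv]
  map_smul' u v := by rw [RingHom.id_apply, smul_twistTwist t hba, toLoc_smul]

theorem exists_of_twLocUnit_eq_zero {a b : ℂ} (hba : b + a = 0) {v : N}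
    (h : t.twLocUnit N hba v = 0) : ∃ l : ℕ, (envι t.f : Env 𝔤) ^ l • v = 0 := by
  have h1 : ((v /ₒ (1 : t.S)) : OreLocalization t.S N) = 0 := t.eq_zero_of_twistTwist_eq_zero h
  rw [← fS_zero] at h1
  exact t.oreDiv_eq_zero h1

/-- Clearing a denominator shows that the cokernel of `twLocUnit` is f-torsion, as its kernel is. -/
theorem exists_f_pow_smul_mem_range_twLocUnit {a b : ℂ} (hba : b + a = 0)
    (x : t.TwLoc b (t.TwLoc a N)) :
    ∃ k : ℕ, (envι t.f : Env 𝔤) ^ k • x ∈ LinearMap.range (t.twLocUnit N hba) := by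
  obtain ⟨w, rfl⟩ := t.twistTwist_surjective a b x
  obtain ⟨k, v, rfl⟩ := t.exists_oreDiv w
  refine ⟨k, v, ?_⟩
  rw [smul_twistTwist t hba, ← fUnit_pow_val, oreDiv_fS, ← mul_smul, mul_finv_pow, one_smul]
  rfl

end DoubleTwist

theorem locMap_injective {N N' : Type u} [AddCommGroup N] [Module (Env 𝔤) N]
    [AddCommGroup N'] [Module (Env 𝔤) N'] {ψ : N →ₗ[Env 𝔤] N'} (hψ : Function.Injective ψ) :
    Function.Injective (t.locMap ψ) := by
  rw [injective_iff_map_eq_zero]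
  intro w hw
  obtain ⟨k, v, rfl⟩ := t.exists_oreDiv w
  rw [locMap_oreDiv] at hw
  obtain ⟨l, hl⟩ := t.oreDiv_eq_zero hw
  rw [← map_smul] at hl
  exact t.oreDiv_eq_zero_of ((map_eq_zero_iff ψ hψ).mp hl)

end LocFinSl2

/-! ### Injective even maps: gradings, inverses and lifts -/

namespace SuperModule

variable {𝔤 : Type u} [AddCommGroup 𝔤] [Module ℂ 𝔤] [LieSuperalgebra 𝔤] {M N : SuperModule 𝔤}

/-- The component of v in the other degree has image in both homogeneous parts of N; that image is
0, so the component is 0 by injectivity. -/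
theorem Hom.mem_gr_of_injective {ψ : M ⟶ N} (h : Function.Injective (Hom.lin ψ)) {i : ZMod 2}
    {v : M} (hv : Hom.lin ψ v ∈ N.gr i) : v ∈ M.gr i := by
  have key : ∀ (i j : ZMod 2) (u u' : M), IsCompl (N.gr i) (N.gr j) → u ∈ M.gr i → u' ∈ M.gr j →
      Hom.lin ψ (u + u') ∈ N.gr i → u + u' ∈ M.gr i := by
    intro i j u u' hc hu hu' hmem
    rw [map_add] at hmem
    have h1 := (Submodule.add_mem_iff_right _ (Hom.lin_mem ψ hu)).mp hmem
    have h2 := Submodule.disjoint_def.mp hc.disjoint _ h1 (Hom.lin_mem ψ hu')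
    rw [(map_eq_zero_iff _ h).mp h2, add_zero]
    exact hu
  obtain ⟨u, hu, u', hu', rfl⟩ := exists_add_of_isInternal M.isInternal v
  have hc := isCompl_of_isInternal N.isInternal
  have hi : ∀ i : ZMod 2, i = 0 ∨ i = 1 := by decide
  rcases hi i with rfl | rfl
  · exact key 0 1 u u' hc hu hu' hv
  · rw [add_comm] at hv ⊢
    exact key 1 0 u' u hc.symm hu' hu hv

theorem Hom.isIso_of_bijective (ψ : M ⟶ N) (h : Function.Bijective (Hom.lin ψ)) : IsIso ψ := by
  let E := LinearEquiv.ofBijective (Hom.lin ψ) h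
  have hE : ∀ v, Hom.lin ψ (E.symm v) = v := E.apply_symm_apply
  refine ⟨Hom.mk E.symm.toLinearMap fun i v hv => ?_,
    Hom.ext' E.symm_apply_apply, Hom.ext' hE⟩
  rw [← hE v] at hv
  exact Hom.mem_gr_of_injective h.1 hv

theorem Hom.exists_lift {P : SuperModule 𝔤} (ψ : M ⟶ P) (χ : N ⟶ P)
    (h : Function.Injective (Hom.lin χ)) (hψ : ∀ v, ∃ y, Hom.lin χ y = Hom.lin ψ v) :
    ∃ η : M ⟶ N, ∀ v, Hom.lin χ (Hom.lin η v) = Hom.lin ψ v := by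
  choose η hη using hψ
  refine ⟨Hom.mk { toFun := η, map_add' := fun v w => h ?_, map_smul' := fun u v => h ?_ }
    fun i v hv => Hom.mem_gr_of_injective h ?_, hη⟩
  · rw [map_add, hη, hη, hη, map_add]
  · rw [map_smul, hη, hη, map_smul, RingHom.id_apply]
  · change Hom.lin χ (η v) ∈ _
    rw [hη]
    exact Hom.lin_mem ψ hv

end SuperModule

/-! ### Enough e-finite vectors in the twisted localization -/

namespace LocFinSl2

variable {𝔤 : Type u} [AddCommGroup 𝔤] [Module ℂ 𝔤] [LieSuperalgebra 𝔤] (t : LocFinSl2 𝔤)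

theorem commute_f_aeval_casimir (P : Polynomial ℂ) :
    Commute (envι t.f : Env 𝔤) (Polynomial.aeval t.casimir P) := by
  induction P using Polynomial.induction_on' with
  | add P Q hP hQ => rw [map_add]; exact hP.add_right hQ
  | monomial n r =>
    rw [Polynomial.aeval_monomial]
    exact (Algebra.commute_algebraMap_right r _).mul_right (t.commute_f_casimir.pow_right n)

section Modules

variable {X : Type u} [AddCommGroup X] [Module ℂ X] [Module (Env 𝔤) X] [IsScalarTower ℂ (Env 𝔤) X]

theorem h_smul_twist_oreDiv_one (a : ℂ) {c : ℂ} {v : X}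
    (hv : (envι t.h : Env 𝔤) • v = c • v) :
    (envι t.h : Env 𝔤) • t.twist a X (v /ₒ (1 : t.S)) =
      (c - 2 * a) • t.twist a X (v /ₒ (1 : t.S)) := by
  have h1 := t.h_smul_oreDiv hv 0
  rw [fS_zero, Nat.cast_zero, mul_zero, add_zero] at h1
  rw [smul_twist, φ_h, sub_smul, h1, algebraMap_smul, ← sub_smul, map_smul]

theorem exists_twist_f_pow_smul_mem_gammaSub (a : ℂ) (n : ℤ) {v : X}
    (hv : (envι t.h : Env 𝔤) • v = (a + n : ℂ) • v) {m : ℕ}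
    (he : (envι t.e : Env 𝔤) ^ m • v = 0) :
    ∃ k : ℕ, t.twist a X (((envι t.f : Env 𝔤) ^ k • v) /ₒ (1 : t.S)) ∈
      t.gammaSub (t.TwLoc a X) := by
  -- The exponent k = max(n + m, 0) makes s = k - (n + m) a natural number, as the reflection of
  -- weights requires.
  obtain ⟨s, hs⟩ := Int.eq_ofNat_of_zero_le (sub_nonneg.mpr (Int.self_le_toNat (n + m)))
  set k := (n + m).toNat
  refine ⟨k, ?_⟩
  set x := t.twist a X (((envι t.f : Env 𝔤) ^ k • v) /ₒ (1 : t.S)) with hx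
  have h1 := t.h_smul_twist_oreDiv_one a (t.h_smul_f_pow_smul hv k)
  -- The polynomial kills v because it acts there as f^m e^m; commuting with f, it passes through
  -- both f^k and the twist.
  have h2 : Polynomial.aeval t.casimir (casimirPoly (a + n) m) • x = 0 := by
    have hc := t.commute_f_aeval_casimir (casimirPoly (a + n) m)
    rw [hx, smul_twist_of_commute t a hc, toLoc_smul, ← mul_smul, ← (hc.pow_left k).eq, mul_smul,
      ← t.f_pow_e_pow_smul hv, he, smul_zero, smul_zero, OreLocalization.zero_oreDiv, map_zero]
  have hs' : (k : ℂ) - (n + m) = s := by exact_mod_cast congrArg (Int.cast : ℤ → ℂ) hs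
  -- The old and new weights add up to 2n - 2k = -2m - 2s. The cancellation of a here is why the
  -- twist must match the weight coset of the module.
  obtain ⟨Q, hQ⟩ := casimirPoly_dvd (a + n) (a + n - 2 * k - 2 * a) m s
    (by linear_combination (-2 : ℂ) * hs')
  have h3 := t.f_pow_e_pow_smul h1 (s + m)
  rw [hQ, mul_comm, map_mul, mul_smul, h2, smul_zero] at h3
  exact t.mem_gammaSub_of_e_pow_smul (t.eq_zero_of_f_pow_smul_twLoc h3)

end Modules

theorem smul_fpow_of_commute (a : ℂ) {N : SuperModule 𝔤} {u : Env 𝔤} (hu : Commute (envι t.f) u)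
    (v : N) : u • t.fpow a v = t.fpow a (u • v) := by
  change u • t.twist a N _ = t.twist a N _
  rw [smul_twist_of_commute t a hu, toLoc_smul]

theorem fpow_add (a : ℂ) {N : SuperModule 𝔤} (v w : N) :
    t.fpow a (v + w) = t.fpow a v + t.fpow a w := by
  change t.twist a N _ = t.twist a N _ + t.twist a N _
  rw [← map_add, OreLocalization.add_oreDiv]

theorem fpow_smul (a : ℂ) {N : SuperModule 𝔤} (c : ℂ) (v : N) :
    t.fpow a (c • v) = c • t.fpow a v := by
  rw [← algebraMap_smul (Env 𝔤) c v, ← smul_fpow_of_commute t a (Algebra.commutes c _).symm,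
    algebraMap_smul]

theorem exists_fpow_mem_gammaSub {a : ℂ} {N : SuperModule 𝔤} (hN : t.IsMe a N) (v : N) :
    ∃ k : ℕ, t.fpow a ((envι t.f : Env 𝔤) ^ k • v) ∈ t.gammaSub (t.twLocObj N a) := by
  induction hN.1 v using Submodule.span_induction with
  | mem x hx =>
    obtain ⟨n, hn⟩ := hx
    obtain ⟨m, hm⟩ := hN.2 x
    exact t.exists_twist_f_pow_smul_mem_gammaSub a n hn hm
  | zero =>
    refine ⟨0, ?_⟩
    rw [smul_zero, ← zero_smul ℂ (0 : N), fpow_smul, zero_smul]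
    exact Submodule.zero_mem _
  | add x y _ _ hx hy =>
    obtain ⟨k, hk⟩ := hx
    obtain ⟨l, hl⟩ := hy
    -- Multiplying by further powers of f stays in the submodule, so k + l serves both summands.
    have h1 := Submodule.smul_mem _ ((envι t.f : Env 𝔤) ^ l) hk
    have h2 := Submodule.smul_mem _ ((envι t.f : Env 𝔤) ^ k) hl
    rw [smul_fpow_of_commute t a ((Commute.refl _).pow_right _), ← mul_smul, ← pow_add] at h1 h2
    rw [add_comm l k] at h1
    refine ⟨k + l, ?_⟩
    rw [smul_add, fpow_add]
    exact Submodule.add_mem _ h1 h2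
  | smul c x _ hx =>
    obtain ⟨k, hk⟩ := hx
    refine ⟨k, ?_⟩
    rw [smul_comm, fpow_smul]
    exact Submodule.smul_of_tower_mem _ c hk

/-! ### The canonical transformation and the equivalence -/

section Unit

variable (a b : ℂ)

/-- The canonical map `C_b(C_a(N)) → D_b(D_a(N))`. -/
noncomputable def enrightEnrightι (N : SuperModule 𝔤) :
    (t.enright b).obj ((t.enright a).obj N) ⟶ (t.twLoc b).obj ((t.twLoc a).obj N) :=
  t.enrightι b ((t.enright a).obj N) ≫ (t.twLoc b).map (t.enrightι a N)

theorem twLoc_map_injective {M N : SuperModule 𝔤} {ψ : M ⟶ N}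
    (hψ : Function.Injective (SuperModule.Hom.lin ψ)) :
    Function.Injective (SuperModule.Hom.lin ((t.twLoc a).map ψ)) :=
  (t.twist a N).injective.comp ((t.locMap_injective hψ).comp (t.twist a M).symm.injective)

theorem enrightι_injective (N : SuperModule 𝔤) :
    Function.Injective (SuperModule.Hom.lin (t.enrightι a N)) :=
  Subtype.val_injective

theorem enrightEnrightι_injective (N : SuperModule 𝔤) :
    Function.Injective (SuperModule.Hom.lin (t.enrightEnrightι a b N)) :=
  (t.twLoc_map_injective b (t.enrightι_injective a N)).comp (t.enrightι_injective b _)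

variable {a b}

theorem mem_gammaSub_of_injective {X Y : Type u} [AddCommGroup X] [Module ℂ X] [Module (Env 𝔤) X]
    [IsScalarTower ℂ (Env 𝔤) X] [AddCommGroup Y] [Module ℂ Y] [Module (Env 𝔤) Y]
    [IsScalarTower ℂ (Env 𝔤) Y] {ψ : X →ₗ[Env 𝔤] Y} (hψ : Function.Injective ψ) {x : X} {p : ℕ}
    (h : (envι t.e : Env 𝔤) ^ p • ψ x = 0) : x ∈ t.gammaSub X :=
  t.mem_gammaSub_of_e_pow_smul ((map_eq_zero_iff ψ hψ).mp ((map_smul ψ _ _).trans h))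

/-- The canonical map `N → D_b(D_a(N))`, `v ↦ f^b ⊗ (f^a ⊗ v)`, for `b = -a`. -/
noncomputable def twLocUnitHom (hba : b + a = 0) (N : SuperModule 𝔤) :
    N ⟶ (t.twLoc b).obj ((t.twLoc a).obj N) :=
  SuperModule.Hom.mk (N := (t.twLoc b).obj ((t.twLoc a).obj N)) (t.twLocUnit N hba) (by
    intro i v hv
    have h1 : t.twist a N (v /ₒ (1 : t.S)) ∈ ((t.twLoc a).obj N).gr i :=
      ⟨_, ⟨0, v, hv, by rw [fS_zero]⟩, rfl⟩
    exact ⟨_, ⟨0, _, h1, by rw [fS_zero]; rfl⟩, rfl⟩)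

theorem enrightEnrightι_naturality {M N : SuperModule 𝔤} (ψ : M ⟶ N) :
    (t.enright b).map ((t.enright a).map ψ) ≫ t.enrightEnrightι a b N =
      t.enrightEnrightι a b M ≫ (t.twLoc b).map ((t.twLoc a).map ψ) := by
  have h : ∀ (c : ℂ) {M N : SuperModule 𝔤} (ψ : M ⟶ N), (t.enright c).map ψ ≫ t.enrightι c N =
    t.enrightι c M ≫ (t.twLoc c).map ψ := fun c _ _ ψ => t.gammaι.naturality ((t.twLoc c).map ψ)
  rw [enrightEnrightι, enrightEnrightι, ← Category.assoc, h b, Category.assoc, Category.assoc,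
    ← Functor.map_comp, ← Functor.map_comp, h a]

/-- The vector f^b ⊗ (f^a ⊗ v) is rewritten as f^b ⊗ f^{-k}(f^a ⊗ f^k v), whose inner vector lies in
C_a(N) for suitable k. It is e-nilpotent because v is and v ↦ f^b ⊗ (f^a ⊗ v) is linear over `Env
𝔤`. -/
theorem exists_enrightEnrightι_eq (hba : b + a = 0) {N : SuperModule 𝔤} (hN : t.IsMe a N) (v : N) :
    ∃ y, SuperModule.Hom.lin (t.enrightEnrightι a b N) y = SuperModule.Hom.lin (t.twLocUnitHom hba N) v := by
  obtain ⟨k, hk⟩ := t.exists_fpow_mem_gammaSub hN v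
  let x : (t.enright a).obj N := ⟨_, hk⟩
  let z : (t.twLoc b).obj ((t.enright a).obj N) :=
    t.twist b ((t.enright a).obj N) (x /ₒ t.fS k)
  have hz : SuperModule.Hom.lin ((t.twLoc b).map (t.enrightι a N)) z = SuperModule.Hom.lin (t.twLocUnitHom hba N) v := by
    change t.twist b (t.TwLoc a N) (t.twist a N (((envι t.f : Env 𝔤) ^ k • v) /ₒ 1) /ₒ t.fS k) =
      t.twist b (t.TwLoc a N) (t.twist a N (v /ₒ 1) /ₒ 1)
    rw [← toLoc_smul, ← smul_twist_of_commute t a ((Commute.refl _).pow_right k), ← fS_zero,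
      oreDiv_expand t (t.twist a N _) 0 k]
    rfl
  obtain ⟨p, hp⟩ := hN.2 v
  refine ⟨⟨z, t.mem_gammaSub_of_injective (p := p)
    (t.twLoc_map_injective b (t.enrightι_injective a N)) ?_⟩, hz⟩
  rw [hz]
  exact (map_smul (SuperModule.Hom.lin (t.twLocUnitHom hba N)) _ _).symm.trans
    ((congrArg _ hp).trans (map_zero _))

/-- The canonical map `N → C_b(C_a(N))` for `b = -a`. -/
noncomputable def enrightUnitApp (hba : b + a = 0) {N : SuperModule 𝔤} (hN : t.IsMe a N) :
    N ⟶ (t.enright b).obj ((t.enright a).obj N) :=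
  (SuperModule.Hom.exists_lift (t.twLocUnitHom hba N) (t.enrightEnrightι a b N)
    (t.enrightEnrightι_injective a b N) (t.exists_enrightEnrightι_eq hba hN)).choose

theorem enrightEnrightι_enrightUnitApp (hba : b + a = 0) {N : SuperModule 𝔤} (hN : t.IsMe a N)
    (v : N) : SuperModule.Hom.lin (t.enrightEnrightι a b N)
      (SuperModule.Hom.lin (t.enrightUnitApp hba hN) v) = SuperModule.Hom.lin (t.twLocUnitHom hba N) v :=
  (SuperModule.Hom.exists_lift (t.twLocUnitHom hba N) (t.enrightEnrightι a b N)
    (t.enrightEnrightι_injective a b N) (t.exists_enrightEnrightι_eq hba hN)).choose_spec v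

/-- The canonical natural transformation `Id → C_b C_a` on `M(a)^e` for `b = -a`. -/
noncomputable def enrightUnit (hab : a + b = 0) (hba : b + a = 0) :
    𝟭 (t.IsMe a).FullSubcategory ⟶ t.enrightRes hab ⋙ t.enrightRes hba where
  app M := ObjectProperty.homMk (t.enrightUnitApp hba M.property)
  naturality M N ψ := by
    apply ObjectProperty.hom_ext
    apply SuperModule.Hom.ext'
    intro v
    -- Naturality may be tested in D_b D_a(N), where both sides have explicit formulas.
    apply t.enrightEnrightι_injective a b N.obj
    have h1 := t.enrightEnrightι_enrightUnitApp hba M.property v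
    have h2 := congrArg (fun η => SuperModule.Hom.lin η
      (SuperModule.Hom.lin (t.enrightUnitApp hba M.property) v))
      (t.enrightEnrightι_naturality (a := a) (b := b) ψ.hom)
    refine (t.enrightEnrightι_enrightUnitApp hba N.property (SuperModule.Hom.lin ψ.hom v)).trans
      (Eq.trans ?_ h2.symm)
    exact (congrArg (SuperModule.Hom.lin ((t.twLoc b).map ((t.twLoc a).map ψ.hom))) h1).symm

/-- A submodule contains the weight components of its vectors; each component is then e- and
f-nilpotent of non-integral weight. -/
theorem f_locNilp_eq_zero {N : SuperModule 𝔤} (hN : t.IsMe a N) (ha : ¬ ∃ n : ℤ, a = n)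
    (W : Submodule (Env 𝔤) N)
    (hW : ∀ v ∈ W, ∃ l : ℕ, (envι t.f : Env 𝔤) ^ l • v = 0) : W = ⊥ := by
  rw [eq_bot_iff]
  intro v hv
  obtain ⟨s, w, hw, rfl⟩ := t.exists_sum a (hN.1 v)
  have hmem := t.mem_of_sum_mem W a s w (fun n _ => hw n) hv
  refine (Submodule.mem_bot _).mpr (Finset.sum_eq_zero fun n hn => ?_)
  obtain ⟨l, hl⟩ := hW _ (hmem n hn)
  obtain ⟨p, hp⟩ := hN.2 (w n)
  refine t.eq_zero_of_f_pow_smul_eq_zero ?_ (hw n) hp hl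
  rintro ⟨m, hm⟩
  exact ha ⟨m - n, by push_cast; linear_combination hm⟩

theorem enrightUnitApp_injective (hba : b + a = 0) {N : SuperModule 𝔤} (hN : t.IsMe a N)
    (ha : ¬ ∃ n : ℤ, a = n) :
    Function.Injective (SuperModule.Hom.lin (t.enrightUnitApp hba hN)) := by
  rw [← LinearMap.ker_eq_bot]
  refine t.f_locNilp_eq_zero hN ha _ fun v hv => ?_
  have h1 := t.enrightEnrightι_enrightUnitApp hba hN v
  rw [LinearMap.mem_ker.mp hv, map_zero] at h1
  exact t.exists_of_twLocUnit_eq_zero hba h1.symm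

theorem enrightUnitApp_surjective (hab : a + b = 0) (hba : b + a = 0) {N : SuperModule 𝔤}
    (hN : t.IsMe a N) (ha : ¬ ∃ n : ℤ, a = n) :
    Function.Surjective (SuperModule.Hom.lin (t.enrightUnitApp hba hN)) := by
  have hCN := t.isMe_enright hba (t.isMe_enright hab hN.1).1
  set Φ := SuperModule.Hom.lin (t.enrightUnitApp hba hN)
  let I := SuperModule.Hom.lin (t.enrightEnrightι a b N)
  let R : Submodule (Env 𝔤) ((t.twLoc b).obj ((t.twLoc a).obj N)) :=
    LinearMap.range (SuperModule.Hom.lin (t.twLocUnitHom hba N))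
  -- The quotient of D_b D_a(N) by the image of N replaces the cokernel of Φ: f-torsion is already
  -- known there, and injectivity of I brings vanishing back.
  let π := R.mkQ ∘ₗ I
  have hπ : ∀ y, π y = 0 → y ∈ LinearMap.range Φ := by
    intro y hy
    obtain ⟨v, hv⟩ := (Submodule.Quotient.mk_eq_zero R).mp hy
    exact ⟨v, t.enrightEnrightι_injective a b N
      ((t.enrightEnrightι_enrightUnitApp hba hN v).trans hv)⟩
  have hweight : ∀ (n : ℤ) (y : (t.enright b).obj ((t.enright a).obj N)),
      (envι t.h : Env 𝔤) • y = (a + n : ℂ) • y → π y = 0 := by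
    intro n y hy
    obtain ⟨p, hp⟩ := hCN.2 y
    obtain ⟨k, hk⟩ := t.exists_f_pow_smul_mem_range_twLocUnit hba (I y)
    refine t.eq_zero_of_f_pow_smul_eq_zero (c := a + n) (p := p) (k := k) ?_ ?_ ?_ ?_
    · rintro ⟨m, hm⟩
      exact ha ⟨m - n, by push_cast; linear_combination hm⟩
    · rw [← map_smul, hy, ← algebraMap_smul (Env 𝔤), map_smul, algebraMap_smul]
    · rw [← map_smul, hp, map_zero]
    · exact (Submodule.Quotient.mk_eq_zero R).mpr hk
  intro y
  obtain ⟨s, w, hw, rfl⟩ := t.exists_sum a (hCN.1 y)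
  exact hπ _ (by rw [map_sum]; exact Finset.sum_eq_zero fun n _ => hweight n _ (hw n))

theorem isIso_enrightUnit (hab : a + b = 0) (hba : b + a = 0) (ha : ¬ ∃ n : ℤ, a = n) :
    IsIso (t.enrightUnit hab hba) := by
  have : ∀ M, IsIso ((t.enrightUnit hab hba).app M) := fun M =>
    (ObjectProperty.isIso_hom_iff _).mp (SuperModule.Hom.isIso_of_bijective
      (t.enrightUnitApp hba M.property) ⟨t.enrightUnitApp_injective hba M.property ha,
        t.enrightUnitApp_surjective hab hba M.property ha⟩)
  exact NatIso.isIso_of_isIso_app _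

/-- The unit for (a, b) and the inverse of the unit for (b, a) give the equivalence. Taking b with a
+ b = 0, instead of -a, makes the situation symmetric and avoids comparing -(-a) with a. -/
theorem isEquivalence_enrightRes (hab : a + b = 0) (hba : b + a = 0) (ha : ¬ ∃ n : ℤ, a = n) :
    (t.enrightRes hab).IsEquivalence := by
  have hb : ¬ ∃ n : ℤ, b = n := fun ⟨n, hn⟩ =>
    ha ⟨-n, by push_cast; linear_combination hab - hn⟩
  have := t.isIso_enrightUnit hab hba ha
  have := t.isIso_enrightUnit hba hab hb
  exact (CategoryTheory.Equivalence.mk (t.enrightRes hab) (t.enrightRes hba)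
    (asIso (t.enrightUnit hab hba)) (asIso (t.enrightUnit hba hab)).symm).isEquivalence_functor

end Unit

/-! ### Faithfulness on maps into f-torsion-free modules -/

theorem enright_map_injective {a : ℂ} {N₁ N₂ : SuperModule 𝔤} (h₁ : t.IsMe a N₁)
    (h₂ : t.fNil N₂ = {0}) :
    Function.Injective (fun ψ : N₁ ⟶ N₂ => (t.enright a).map ψ) := by
  intro ψ χ h
  apply SuperModule.Hom.ext'
  intro v
  obtain ⟨k, hk⟩ := t.exists_fpow_mem_gammaSub h₁ v
  -- The vector f^a ⊗ f^k v lies in C_a(N₁), so the equality of the induced maps can be evaluated on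
  -- it.
  have h3 : t.fpow a (SuperModule.Hom.lin ψ ((envι t.f : Env 𝔤) ^ k • v)) =
      t.fpow a (SuperModule.Hom.lin χ ((envι t.f : Env 𝔤) ^ k • v)) :=
    congrArg (fun η : (t.enright a).obj N₁ ⟶ (t.enright a).obj N₂ =>
      SuperModule.Hom.lin (t.enrightι a N₂) (SuperModule.Hom.lin η ⟨_, hk⟩)) h
  rw [map_smul, map_smul, ← sub_eq_zero] at h3
  have h4 : (((envι t.f : Env 𝔤) ^ k • (SuperModule.Hom.lin ψ v - SuperModule.Hom.lin χ v) /ₒ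
      t.fS 0) : OreLocalization t.S N₂) = 0 := by
    rw [smul_sub, sub_eq_add_neg, ← OreLocalization.add_oreDiv, ← OreLocalization.neg_def,
      ← sub_eq_add_neg, fS_zero]
    exact h3
  obtain ⟨l, hl⟩ := t.oreDiv_eq_zero h4
  rw [← mul_smul, ← pow_add] at hl
  -- Vanishing in the localization costs f^l on top of the f^k already applied.
  have h5 : SuperModule.Hom.lin ψ v - SuperModule.Hom.lin χ v ∈ t.fNil N₂ := by
    refine ⟨l + k, fun s hs => ?_⟩
    obtain ⟨r, rfl⟩ := Nat.exists_eq_add_of_le' hs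
    rw [pow_add, mul_smul, hl, smul_zero]
  rw [h₂] at h5
  exact sub_eq_zero.mp h5

/-- The map `Hom(M, N) → Hom(C_a(M), C_a(N))`. -/
noncomputable def enrightMapLin (a : ℂ) (M N : SuperModule 𝔤) :
    (M ⟶ N) →ₗ[ℂ] ((t.enright a).obj M ⟶ (t.enright a).obj N) where
  toFun ψ := (t.enright a).map ψ
  map_add' ψ χ := by
    apply SuperModule.Hom.ext'
    rintro ⟨x, hx⟩
    apply Subtype.ext
    obtain ⟨w, rfl⟩ := (t.twist a M).surjective x
    obtain ⟨k, v, rfl⟩ := t.exists_oreDiv w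
    exact (OreLocalization.add_oreDiv (r := SuperModule.Hom.lin ψ v)
      (r' := SuperModule.Hom.lin χ v) (s := t.fS k)).symm
  map_smul' c ψ := by
    apply SuperModule.Hom.ext'
    rintro ⟨x, hx⟩
    apply Subtype.ext
    obtain ⟨w, rfl⟩ := (t.twist a M).surjective x
    obtain ⟨k, v, rfl⟩ := t.exists_oreDiv w
    exact (t.smul_oreDiv_fS c (SuperModule.Hom.lin ψ v) k).symm

end LocFinSl2

end TwistedLocalization

theorem mainTheorem8 {𝔤 : Type u} [AddCommGroup 𝔤] [Module ℂ 𝔤] [LieSuperalgebra 𝔤]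
    (t : LocFinSl2 𝔤) :
    (∀ a : ℂ,
      ∃ Φ : 𝟭 (t.IsMe a).FullSubcategory ⟶
          t.enrightRes (add_neg_cancel a) ⋙ t.enrightRes (neg_add_cancel a),
        ∀ (M : (t.IsMe a).FullSubcategory) (v : M.obj),
          SuperModule.Hom.lin ((t.twLoc (-a)).map (t.enrightι a M.obj))
            (SuperModule.Hom.lin (t.enrightι (-a) ((t.enright a).obj M.obj))
              (SuperModule.Hom.lin (Φ.app M).hom v)) =
          t.fpow (-a) (t.fpow a v)) ∧
    (∀ a : ℂ, (¬ ∃ n : ℤ, a = n) →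
      (t.enrightRes (add_neg_cancel a) :
        (t.IsMe a).FullSubcategory ⥤ (t.IsMe (-a)).FullSubcategory).IsEquivalence) ∧
    (∀ N₁ N₂ : SuperModule 𝔤, t.IsMe 0 N₁ → t.IsMe 0 N₂ → t.fNil N₂ = {0} →
      Function.Injective
        (fun ψ : N₁ ⟶ N₂ =>
          ((t.enright 0).map ψ : (t.enright 0).obj N₁ ⟶ (t.enright 0).obj N₂)) ∧
      Module.rank ℂ (N₁ ⟶ N₂) ≤
        Module.rank ℂ ((t.enright 0).obj N₁ ⟶ (t.enright 0).obj N₂)) := by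
  refine ⟨fun a => ⟨t.enrightUnit _ _, fun M v => ?_⟩, fun a ha =>
    t.isEquivalence_enrightRes _ (neg_add_cancel a) ha, fun N₁ N₂ h₁ _ hf => ?_⟩
  · exact t.enrightEnrightι_enrightUnitApp (neg_add_cancel a) M.property v
  · have h := t.enright_map_injective h₁ hf
    exact ⟨h, LinearMap.rank_le_of_injective (t.enrightMapLin 0 N₁ N₂) h⟩
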